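/- Let $(M,g)$ be a smooth Riemannian manifold of dimension $n$ with Levi-Civita connection $\nabla$, let $I\subset\mathbb{R}$ be an interval with more than one point, and let $p>0$. For a smooth curve $\gamma\colon I\to M$ write $\tau(\gamma)=\nabla_{\gamma'}\gamma'$; the curve is a geodesic if $\tau(\gamma)=0$ on $I$, and if $|\gamma'|=1$ its geodesic curvature is $k=|\tau(\gamma)|$. The curve $\gamma$ is called $p$-biharmonic if it is a critical point of the energy $$E_{2,p}(\gamma)=\frac1p\int_I|\tau(\gamma)|^p\,ds$$ with respect to smooth variations with compact support in the interior of $I$, that is, if for every $[a,b]$ in the interior of $I$ and every smooth variation $\gamma_t$ of $\gamma$ that agrees with $\gamma$ outside $(a,b)$, the derivative $\frac{d}{dt}\big|_{t=0}\frac1p\int_a^b|\tau(\gamma_t)|^p\,ds$ exists and vanishes. (If $p\le 1$, where $|\cdot|^p$ is not differentiable at $0$, only variations are considered for which $\tau(\gamma)\ne0$ on $[a,b]$.) Theorem. Let $\gamma\colon I\to M$ be a smooth $p$-biharmonic curve parametrized by arclength, and suppose that all sectional curvatures of $M$ are non-positive. If $p=\frac12$, suppose in addition that $\gamma$ has constant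 geodesic curvature. Then $\gamma$ is a geodesic. -/

import Mathlib

open Set MeasureTheory Bundle
open scoped Manifold ContDiff Topology

noncomputable section

namespace PBiharmonic

/-- The model space of an `n`-dimensional manifold. -/
abbrev Model (n : ℕ) : Type := EuclideanSpace ℝ (Fin n)

section LocalCoordinates

/-!
### Riemannian geometry in a coordinate domain

The coordinate space is a vector space `E`; for an `n`-dimensional manifold it is `ℝⁿ`.
A metric in coordinates is a map `G`, sending a coordinate point `y` to the bilinear form `g_y`.
Vectors are coordinate vectors.
-/

variable {E : Type*} [NormedAddCommGroup E] [NormedSpace ℝ E]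

/-- The Christoffel symbol of the first kind `½ (∂_v g(w, u) + ∂_w g(v, u) - ∂_u g(v, w))`,
as a linear form in `u`. -/
def christoffelForm (G : E → E →L[ℝ] E →L[ℝ] ℝ) (y v w : E) :
    E →L[ℝ] ℝ :=
  (2⁻¹ : ℝ) • (fderiv ℝ G y v w + fderiv ℝ G y w v
    - ((ContinuousLinearMap.apply ℝ ℝ w).comp
        ((ContinuousLinearMap.apply ℝ (E →L[ℝ] ℝ) v).comp (fderiv ℝ G y))))

/-- The Christoffel symbol `Γ_y(v, w)` of the Levi-Civita connection, with components
`Γ^k_{ij} v^i w^j`: the vector that represents `christoffelForm G y v w` with respect to `g_y`.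
The map `G y` is invertible since `g_y` is positive definite. -/
def christoffel (G : E → E →L[ℝ] E →L[ℝ] ℝ) (y v w : E) : E :=
  (G y).inverse (christoffelForm G y v w)

/-- The curvature tensor `R(X, Y) Z = ∇_X ∇_Y Z - ∇_Y ∇_X Z - ∇_{[X, Y]} Z` at `y`, computed
for constant coordinate vector fields `X, Y, Z` (for which `[X, Y] = 0` and
`∇_X Z = Γ(X, Z)`). -/
def curvatureTensor (G : E → E →L[ℝ] E →L[ℝ] ℝ) (y X Y Z : E) : E :=
  (fderiv ℝ (fun z => christoffel G z Y Z) y X + christoffel G y X (christoffel G y Y Z))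
    - (fderiv ℝ (fun z => christoffel G z X Z) y Y + christoffel G y Y (christoffel G y X Z))

/-- The sectional curvature of the plane spanned by (linearly independent) `v, w` at `y`. -/
def sectionalCurvature (G : E → E →L[ℝ] E →L[ℝ] ℝ) (y v w : E) : ℝ :=
  G y (curvatureTensor G y v w w) v / (G y v v * G y w w - G y v w ^ 2)

/-- The covariant derivative `∇_{c'} V` at the time `s`, where `c : I → E` is a curve in
coordinates and `V` is a vector field along `c`: in components `(V^k)' + Γ^k_{ij}(c) (c^i)' V^j`.
At an endpoint that belongs to `I` the derivatives are one-sided. -/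
def covDerivAlong (G : E → E →L[ℝ] E →L[ℝ] ℝ) (I : Set ℝ)
    (c V : ℝ → E) (s : ℝ) : E :=
  derivWithin V I s + christoffel G (c s) (derivWithin c I s) (V s)

end LocalCoordinates

section Manifold

variable {n : ℕ} {M : Type*} [TopologicalSpace M] [ChartedSpace (Model n) M]
  [RiemannianBundle (fun x : M => TangentSpace (𝓡 n) x)]

/-- The tangent vector at `x` with the coordinates `v` in the chart `e`. -/
def ofCoord (e : OpenPartialHomeomorph M (Model n)) (x : M) :
    Model n →L[ℝ] TangentSpace (𝓡 n) x :=
  (mfderiv (𝓡 n) 𝓘(ℝ, Model n) e x).inverse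

/-- The Riemannian metric of `M` in the chart `e`, at coordinate points `y ∈ e.target`. -/
def metricInChart (e : OpenPartialHomeomorph M (Model n)) (y : Model n) :
    Model n →L[ℝ] Model n →L[ℝ] ℝ :=
  (innerSL ℝ (E := TangentSpace (𝓡 n) (e.symm y))).bilinearComp
    (ofCoord e (e.symm y)) (ofCoord e (e.symm y))

variable (n M) in
/-- All sectional curvatures of `M` are non-positive. -/
def HasNonposCurvature : Prop :=
  ∀ e ∈ atlas (Model n) M, ∀ y ∈ e.target, ∀ v w : Model n, LinearIndependent ℝ ![v, w] →
    sectionalCurvature (metricInChart e) y v w ≤ 0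

/-- The velocity `γ'(s)` of a curve `γ : I → M`. -/
def velocity (n : ℕ) {M : Type*} [TopologicalSpace M] [ChartedSpace (Model n) M]
    (I : Set ℝ) (γ : ℝ → M) (s : ℝ) : TangentSpace (𝓡 n) (γ s) :=
  mfderivWithin 𝓘(ℝ, ℝ) (𝓡 n) γ I s (1 : ℝ)

/-- The tension field `τ(γ)(s) = ∇_{γ'} γ'` of a curve `γ : I → M`, where `∇` is the Levi-Civita
connection, computed in the preferred chart at `γ s`. -/
def tension (n : ℕ) {M : Type*} [TopologicalSpace M] [ChartedSpace (Model n) M]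
    [RiemannianBundle (fun x : M => TangentSpace (𝓡 n) x)]
    (I : Set ℝ) (γ : ℝ → M) (s : ℝ) : TangentSpace (𝓡 n) (γ s) :=
  let e := chartAt (Model n) (γ s)
  let c : ℝ → Model n := fun r => e (γ r)
  ofCoord e (γ s) (covDerivAlong (metricInChart e) I c (derivWithin c I) s)

/-- The curve `γ : I → M` is parametrized by arclength. -/
def IsUnitSpeed (n : ℕ) {M : Type*} [TopologicalSpace M] [ChartedSpace (Model n) M]
    [RiemannianBundle (fun x : M => TangentSpace (𝓡 n) x)]
    (I : Set ℝ) (γ : ℝ → M) : Prop :=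
  ∀ s ∈ I, ‖velocity n I γ s‖ = 1

/-- The curve `γ : I → M` is a geodesic: `∇_{γ'} γ' = 0` on `I`. -/
def IsGeodesic (n : ℕ) {M : Type*} [TopologicalSpace M] [ChartedSpace (Model n) M]
    [RiemannianBundle (fun x : M => TangentSpace (𝓡 n) x)]
    (I : Set ℝ) (γ : ℝ → M) : Prop :=
  ∀ s ∈ I, tension n I γ s = 0

/-- The geodesic curvature `|∇_{γ'} γ'|` of the unit speed curve `γ : I → M` is constant. -/
def HasConstantGeodesicCurvature (n : ℕ) {M : Type*} [TopologicalSpace M]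
    [ChartedSpace (Model n) M] [RiemannianBundle (fun x : M => TangentSpace (𝓡 n) x)]
    (I : Set ℝ) (γ : ℝ → M) : Prop :=
  ∃ k : ℝ, ∀ s ∈ I, ‖tension n I γ s‖ = k

/-- The energy `(1 / p) ∫_a^b |τ(γ)|^p ds` of the part of `γ : I → M` over `[a, b]`. -/
def energy (n : ℕ) {M : Type*} [TopologicalSpace M] [ChartedSpace (Model n) M]
    [RiemannianBundle (fun x : M => TangentSpace (𝓡 n) x)]
    (p : ℝ) (I : Set ℝ) (a b : ℝ) (γ : ℝ → M) : ℝ :=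
  (1 / p) * ∫ s in a..b, ‖tension n I γ s‖ ^ p

/-- `Γ t s = γ_t(s)` with `t ∈ (-ε, ε)` and `s ∈ I` is a smooth variation of `γ : I → M` that is
supported in `[a, b]`. -/
structure IsVariation (n : ℕ) {M : Type*} [TopologicalSpace M] [ChartedSpace (Model n) M]
    (I : Set ℝ) (γ : ℝ → M) (a b ε : ℝ) (Γ : ℝ → ℝ → M) : Prop where
  smooth : ContMDiffOn 𝓘(ℝ, ℝ × ℝ) (𝓡 n) ∞ (fun q : ℝ × ℝ => Γ q.1 q.2) (Ioo (-ε) ε ×ˢ I)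
  zero : ∀ s ∈ I, Γ 0 s = γ s
  support : ∀ t ∈ Ioo (-ε) ε, ∀ s ∈ I, s ∉ Ioo a b → Γ t s = γ s

/-- The curve `γ : I → M` is `p`-biharmonic: it is a critical point of the energy
`(1 / p) ∫ |τ(γ)|^p ds` with respect to smooth variations with compact support in the interior
of `I`. Such a variation changes the energy only over its support `[a, b]`.

For `p > 1` every such variation is allowed. For `p ≤ 1` the function `|·|^p` is not differentiable
at the origin, so the first variation makes sense only for variations that are supported
where `τ(γ) ≠ 0`. -/
def IsPBiharmonic (n : ℕ) {M : Type*} [TopologicalSpace M] [ChartedSpace (Model n) M]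
    [RiemannianBundle (fun x : M => TangentSpace (𝓡 n) x)]
    (p : ℝ) (I : Set ℝ) (γ : ℝ → M) : Prop :=
  ∀ a b : ℝ, a < b → Icc a b ⊆ interior I →
    (1 < p ∨ ∀ s ∈ Icc a b, tension n I γ s ≠ 0) →
    ∀ ε > 0, ∀ Γ : ℝ → ℝ → M, IsVariation n I γ a b ε Γ →
      HasDerivAt (fun t => energy n p I a b (Γ t)) 0 0

end Manifold

end PBiharmonic

end

/-!
The question is local. If the tension `τ` of `γ` is non-zero at an interior point `s₀` of `I`, fix
a chart at `γ s₀` and an open set `J ∋ s₀` of parameters for which `γ` stays in the chart domain and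
`τ ≠ 0`. The curves `c + t V`, where `c` is `γ` in the chart and `V` vanishes outside `(a, b)`, are
admissible variations (`exists_isVariation`). With `T = c'` and `κ = |τ|²`, differentiation under
the integral gives
`∫ κ^(p/2 - 1) ⟨τ, ∇_T ∇_T V + R(V, T) T⟩ = 0`
(`IsCurveOn.hasDerivAt_sqTension`, `IsCurveOn.integral_firstVariation_eq_zero`). Two choices of `V`,
with a bump function `f`, suffice (`IsCurveOn.not_critical`).

* For `V = f T` an integration by parts gives `(1/2 - p) κ^(p/2 - 1) κ' = 0`, so `κ` is locally
  constant; for `p = 1/2` this is assumed.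
* For `V = f τ` and `κ' = 0` the equation becomes `- |∇_T τ|² + ⟨R(τ, T) T, τ⟩ = 0`. As `τ` and `T`
  are orthogonal and the curvature is non-positive, `∇_T τ = 0`. But `⟨∇_T τ, T⟩ = - |τ|² ≠ 0`.

These fields `V` make the pair symmetry of the curvature tensor unnecessary: only the symmetry of
the Christoffel symbols and their compatibility with the metric are used. The definition of the
tension refers to the preferred chart at each point; by the transformation law of the Christoffel
symbols (`IsMetricOn.christoffel_pullback`) every chart of the atlas gives the same vector
(`tension_eq`). So `τ = 0` in the interior of `I`, and the endpoints follow by continuity.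
-/

noncomputable section

namespace PBiharmonic

-- Instances on spaces of iterated continuous linear maps are not all found at the default depth.
set_option maxSynthPendingDepth 3

/-! ### The Levi-Civita connection in coordinates -/

section Coordinates

variable {E : Type*} [NormedAddCommGroup E] [NormedSpace ℝ E]

/-- `G` is a smooth Riemannian metric on the open subset `U` of the coordinate space. -/
structure IsMetricOn (G : E → E →L[ℝ] E →L[ℝ] ℝ) (U : Set E) : Prop where
  isOpen : IsOpen U
  smooth : ContDiffOn ℝ ∞ G U
  symm : ∀ y ∈ U, ∀ v w, G y v w = G y w v
  pos : ∀ y ∈ U, ∀ v, v ≠ 0 → 0 < G y v v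

/-- The Christoffel symbol as a bundled bilinear map, so that it can be differentiated in `y` and
evaluated on vectors that vary with a parameter. -/
def christoffelCLM (G : E → E →L[ℝ] E →L[ℝ] ℝ) (y : E) : E →L[ℝ] E →L[ℝ] E :=
  (ContinuousLinearMap.compL ℝ E (E →L[ℝ] ℝ) E (G y).inverse).comp
    ((2⁻¹ : ℝ) • (fderiv ℝ G y + (fderiv ℝ G y).flip
      - (ContinuousLinearMap.flipₗᵢ ℝ E E ℝ).toContinuousLinearEquiv.toContinuousLinearMap.comp
          (fderiv ℝ G y).flip))

lemma christoffelCLM_apply (G : E → E →L[ℝ] E →L[ℝ] ℝ) (y v w : E) :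
    christoffelCLM G y v w = christoffel G y v w := by
  unfold christoffelCLM christoffel
  simp only [ContinuousLinearMap.comp_apply, ContinuousLinearMap.compL_apply]
  congr 1

lemma christoffelForm_apply (G : E → E →L[ℝ] E →L[ℝ] ℝ) (y v w u : E) :
    christoffelForm G y v w u =
      2⁻¹ * (fderiv ℝ G y v w u + fderiv ℝ G y w v u - fderiv ℝ G y u v w) := rfl

namespace IsMetricOn

variable {G : E → E →L[ℝ] E →L[ℝ] ℝ} {U : Set E} {y : E}

lemma eq_zero_of_apply_self (h : IsMetricOn G U) (hy : y ∈ U) {v : E} (hv : G y v v = 0) :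
    v = 0 := by
  by_contra hne
  exact (h.pos y hy v hne).ne' hv

lemma ext_right (h : IsMetricOn G U) (hy : y ∈ U) {v w : E} (hvw : ∀ u, G y v u = G y w u) :
    v = w := by
  refine sub_eq_zero.1 (h.eq_zero_of_apply_self hy ?_)
  rw [map_sub (G y), _root_.sub_apply, hvw, sub_self]

lemma differentiableAt (h : IsMetricOn G U) (hy : y ∈ U) : DifferentiableAt ℝ G y :=
  (h.smooth.contDiffAt (h.isOpen.mem_nhds hy)).differentiableAt (by simp)

lemma hasFDerivAt_apply (h : IsMetricOn G U) (hy : y ∈ U) (v w : E) :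
    HasFDerivAt (fun z => G z v w)
      ((ContinuousLinearMap.apply ℝ ℝ w).comp
        ((ContinuousLinearMap.apply ℝ (E →L[ℝ] ℝ) v).comp (fderiv ℝ G y))) y :=
  (ContinuousLinearMap.apply ℝ ℝ w).hasFDerivAt.comp y
    ((ContinuousLinearMap.apply ℝ (E →L[ℝ] ℝ) v).hasFDerivAt.comp y
      (h.differentiableAt hy).hasFDerivAt)

lemma fderiv_symm (h : IsMetricOn G U) (hy : y ∈ U) (z v w : E) :
    fderiv ℝ G y z v w = fderiv ℝ G y z w v := by
  have h1 := h.hasFDerivAt_apply hy v w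
  have h2 := h.hasFDerivAt_apply hy w v
  have h3 : (fun z => G z v w) =ᶠ[𝓝 y] fun z => G z w v := by
    filter_upwards [h.isOpen.mem_nhds hy] with z hz using h.symm z hz v w
  exact DFunLike.congr_fun (h1.unique (h2.congr_of_eventuallyEq h3)) z

lemma christoffel_symm (h : IsMetricOn G U) (hy : y ∈ U) (v w : E) :
    christoffel G y v w = christoffel G y w v := by
  unfold christoffel
  congr 1
  ext u
  rw [christoffelForm_apply, christoffelForm_apply, h.fderiv_symm hy u v w]
  ring

variable [FiniteDimensional ℝ E]

lemma isInvertible (h : IsMetricOn G U) (hy : y ∈ U) : (G y).IsInvertible := by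
  have hinj : Function.Injective (G y) := by
    intro v w hvw
    exact h.ext_right hy fun u => by rw [hvw]
  have hfin : Module.finrank ℝ E = Module.finrank ℝ (E →L[ℝ] ℝ) := by
    rw [← (LinearMap.toContinuousLinearMap (𝕜 := ℝ) (E := E) (F' := ℝ)).finrank_eq]
    exact (Subspace.dual_finrank_eq (K := ℝ) (V := E)).symm
  let e := LinearEquiv.ofInjectiveOfFinrankEq (G y : E →ₗ[ℝ] E →L[ℝ] ℝ) hinj hfin
  exact ⟨e.toContinuousLinearEquiv, by ext; rfl⟩

lemma apply_christoffel (h : IsMetricOn G U) (hy : y ∈ U) (v w u : E) :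
    G y (christoffel G y v w) u =
      2⁻¹ * (fderiv ℝ G y v w u + fderiv ℝ G y w v u - fderiv ℝ G y u v w) := by
  rw [← christoffelForm_apply, christoffel, (h.isInvertible hy).self_apply_inverse]

/-- The Levi-Civita connection is compatible with the metric. -/
lemma fderiv_eq (h : IsMetricOn G U) (hy : y ∈ U) (z u v : E) :
    fderiv ℝ G y z u v = G y (christoffel G y z u) v + G y u (christoffel G y z v) := by
  rw [h.symm y hy u, h.apply_christoffel hy, h.apply_christoffel hy, h.fderiv_symm hy z v u,
    h.fderiv_symm hy u z v, h.fderiv_symm hy v z u]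
  ring

lemma contDiffOn_christoffelCLM (h : IsMetricOn G U) :
    ContDiffOn ℝ ∞ (christoffelCLM G) U := by
  rw [contDiffOn_clm_apply]
  intro v
  rw [contDiffOn_clm_apply]
  intro w
  simp only [christoffelCLM_apply]
  have hD : ContDiffOn ℝ ∞ (fderiv ℝ G) U := h.smooth.fderiv_of_isOpen h.isOpen (by simp)
  have hinv : ContDiffOn ℝ ∞ (fun y => (G y).inverse) U := fun y hy =>
    ((h.isInvertible hy).contDiffAt_map_inverse.comp y
      (h.smooth.contDiffAt (h.isOpen.mem_nhds hy))).contDiffWithinAt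
  refine hinv.clm_apply ?_
  rw [contDiffOn_clm_apply]
  intro u
  simp only [christoffelForm_apply]
  have hd : ∀ a b c : E, ContDiffOn ℝ ∞ (fun y => fderiv ℝ G y a b c) U := fun a b c =>
    ((hD.clm_apply contDiffOn_const).clm_apply contDiffOn_const).clm_apply contDiffOn_const
  exact contDiffOn_const.mul (((hd _ _ _).add (hd _ _ _)).sub (hd _ _ _))

lemma differentiableAt_christoffelCLM (h : IsMetricOn G U) (hy : y ∈ U) :
    DifferentiableAt ℝ (christoffelCLM G) y :=
  (h.contDiffOn_christoffelCLM.contDiffAt (h.isOpen.mem_nhds hy)).differentiableAt (by simp)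

lemma fderiv_christoffel (h : IsMetricOn G U) (hy : y ∈ U) (z v w : E) :
    fderiv ℝ (fun x => christoffel G x v w) y z = fderiv ℝ (christoffelCLM G) y z v w := by
  have h1 : HasFDerivAt (fun x => christoffelCLM G x v w)
      ((ContinuousLinearMap.apply ℝ E w).comp
        ((ContinuousLinearMap.apply ℝ (E →L[ℝ] E) v).comp (fderiv ℝ (christoffelCLM G) y))) y :=
    (ContinuousLinearMap.apply ℝ E w).hasFDerivAt.comp y
      ((ContinuousLinearMap.apply ℝ (E →L[ℝ] E) v).hasFDerivAt.comp y
        (h.differentiableAt_christoffelCLM hy).hasFDerivAt)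
  simp only [christoffelCLM_apply] at h1
  rw [h1.fderiv]
  rfl

lemma fderiv_christoffelCLM_symm (h : IsMetricOn G U) (hy : y ∈ U) (z v w : E) :
    fderiv ℝ (christoffelCLM G) y z v w = fderiv ℝ (christoffelCLM G) y z w v := by
  rw [← h.fderiv_christoffel hy, ← h.fderiv_christoffel hy]
  congr 1
  apply Filter.EventuallyEq.fderiv_eq
  filter_upwards [h.isOpen.mem_nhds hy] with x hx using h.christoffel_symm hx v w

/-- Transformation law of the Christoffel symbols: if near `y` the metric `G` is the pullback of
`G'` by `φ`, then `dφ (Γ(v, w)) = d²φ(v, w) + Γ'(dφ v, dφ w)`. -/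
lemma christoffel_pullback {G' : E → E →L[ℝ] E →L[ℝ] ℝ} {U' : Set E} {φ : E → E}
    (h : IsMetricOn G U) (h' : IsMetricOn G' U') (hy : y ∈ U) (hφy : φ y ∈ U')
    (hφ : ContDiffAt ℝ ∞ φ y) (hsurj : Function.Surjective (fderiv ℝ φ y))
    (hG : ∀ᶠ x in 𝓝 y, ∀ v w, G x v w = G' (φ x) (fderiv ℝ φ x v) (fderiv ℝ φ x w)) (v w : E) :
    fderiv ℝ φ y (christoffel G y v w) =
      fderiv ℝ (fderiv ℝ φ) y v w
        + christoffel G' (φ y) (fderiv ℝ φ y v) (fderiv ℝ φ y w) := by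
  set A := fderiv ℝ φ y with hA
  set B := fderiv ℝ (fderiv ℝ φ) y with hB
  have hdφ : HasFDerivAt φ A y := (hφ.differentiableAt (by simp)).hasFDerivAt
  have hdA : HasFDerivAt (fderiv ℝ φ) B y :=
    ((hφ.fderiv_right (m := ∞) (by simp)).differentiableAt (by simp)).hasFDerivAt
  have hBsymm : ∀ a b, B a b = B b a := fun a b =>
    (hφ.isSymmSndFDerivAt (by simpa using WithTop.coe_le_coe.2 (le_top (a := (2 : ℕ∞))))).eq a b
  have hdG : HasFDerivAt (fun x => G' (φ x)) ((fderiv ℝ G' (φ y)).comp A) y :=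
    (h'.differentiableAt hφy).hasFDerivAt.comp y hdφ
  have key : ∀ z u r, fderiv ℝ G y z u r =
      fderiv ℝ G' (φ y) (A z) (A u) (A r) + G' (φ y) (B z u) (A r)
        + G' (φ y) (A u) (B z r) := by
    intro z u r
    have h1 := h.hasFDerivAt_apply hy u r
    have hu : HasFDerivAt (fun x => fderiv ℝ φ x u) (B.flip u) y := by
      simpa using hdA.clm_apply (hasFDerivAt_const u y)
    have hr : HasFDerivAt (fun x => fderiv ℝ φ x r) (B.flip r) y := by
      simpa using hdA.clm_apply (hasFDerivAt_const r y)
    have h2 := (hdG.clm_apply hu).clm_apply hr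
    have h3 := h1.unique (h2.congr_of_eventuallyEq (hG.mono fun x hx => hx u r))
    have h4 := DFunLike.congr_fun h3 z
    simp only [ContinuousLinearMap.comp_apply, _root_.add_apply,
      ContinuousLinearMap.apply_apply, ContinuousLinearMap.flip_apply] at h4
    rw [h4, ← hA]
    ring
  -- In the Christoffel form the second derivatives of `φ` cancel in pairs, except `d²φ(v, w)`.
  refine h'.ext_right hφy fun u' => ?_
  obtain ⟨u, rfl⟩ := hsurj u'
  have e1 : G' (φ y) (A (christoffel G y v w)) (A u) = G y (christoffel G y v w) u :=
    (hG.self_of_nhds _ _).symm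
  rw [e1, h.apply_christoffel hy, map_add, _root_.add_apply,
    h'.apply_christoffel hφy, key, key, key, hBsymm w v, hBsymm u v, hBsymm u w,
    h'.symm _ hφy (A w) (B v u), h'.symm _ hφy (A v) (B w u)]
  ring

end IsMetricOn

end Coordinates

/-! ### Covariant derivatives along curves -/

section AlongCurves

variable {E : Type*} [NormedAddCommGroup E] [NormedSpace ℝ E]

lemma hasDerivAt_of_contDiffOn {F : Type*} [NormedAddCommGroup F] [NormedSpace ℝ F] {J : Set ℝ}
    (hJ : IsOpen J) {X : ℝ → F} (hX : ContDiffOn ℝ ∞ X J) {s : ℝ} (hs : s ∈ J) :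
    HasDerivAt X (deriv X s) s :=
  ((hX.contDiffAt (hJ.mem_nhds hs)).differentiableAt (by simp)).hasDerivAt

lemma contDiffOn_deriv {F : Type*} [NormedAddCommGroup F] [NormedSpace ℝ F] {J : Set ℝ}
    (hJ : IsOpen J) {X : ℝ → F} (hX : ContDiffOn ℝ ∞ X J) : ContDiffOn ℝ ∞ (deriv X) J :=
  hX.deriv_of_isOpen hJ (by simp)

/-- The covariant derivative `∇_{c'} X` of a vector field `X` along a curve `c` in coordinates, for
two-sided derivatives. -/
def covD (G : E → E →L[ℝ] E →L[ℝ] ℝ) (c X : ℝ → E) (s : ℝ) : E :=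
  deriv X s + christoffel G (c s) (deriv c s) (X s)

lemma covDerivAlong_eq_covD (G : E → E →L[ℝ] E →L[ℝ] ℝ) (c : ℝ → E) {I : Set ℝ} {s : ℝ}
    (hI : I ∈ 𝓝 s) :
    covDerivAlong G I c (derivWithin c I) s = covD G c (deriv c) s := by
  have h1 : derivWithin c I =ᶠ[𝓝 s] deriv c := by
    filter_upwards [eventually_mem_nhds_iff.2 hI] with r hr using derivWithin_of_mem_nhds hr
  rw [covDerivAlong, covD, derivWithin_of_mem_nhds hI, derivWithin_of_mem_nhds hI, h1.deriv_eq]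

/-- The squared norm of the tension of the curve `c + t V` at the parameter `s`,
as a function of `(t, s)`. It is written in terms of the derivatives of `c` and `V`, which makes its
smoothness in `(t, s)` and its derivative in `t` accessible. -/
def sqTension (G : E → E →L[ℝ] E →L[ℝ] ℝ) (c V : ℝ → E) (t s : ℝ) : ℝ :=
  let x := c s + t • V s
  let v := deriv c s + t • deriv V s
  let τ := deriv (deriv c) s + t • deriv (deriv V) s + christoffel G x v v
  G x τ τ

/-- `c` is a smooth curve in the coordinate domain `U`, defined on the open set `J` (its values
outside `J` are arbitrary). -/
structure IsCurveOn (U : Set E) (J : Set ℝ) (c : ℝ → E) : Prop where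
  isOpen : IsOpen J
  smooth : ContDiffOn ℝ ∞ c J
  mapsTo : MapsTo c J U

variable {G : E → E →L[ℝ] E →L[ℝ] ℝ} {U : Set E} {J : Set ℝ} {c X Y V : ℝ → E} {s : ℝ}

lemma sqTension_zero (s : ℝ) : sqTension G c V 0 s =
    G (c s) (covD G c (deriv c) s) (covD G c (deriv c) s) := by
  simp [sqTension, covD]

namespace IsCurveOn

lemma smooth_deriv (hc : IsCurveOn U J c) : ContDiffOn ℝ ∞ (deriv c) J :=
  contDiffOn_deriv hc.isOpen hc.smooth

lemma contDiffOn_metric (h : IsMetricOn G U) (hc : IsCurveOn U J c) (hX : ContDiffOn ℝ ∞ X J)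
    (hY : ContDiffOn ℝ ∞ Y J) : ContDiffOn ℝ ∞ (fun r => G (c r) (X r) (Y r)) J :=
  ((h.smooth.comp hc.smooth hc.mapsTo).clm_apply hX).clm_apply hY

lemma covD_smul (hc : IsCurveOn U J c) {f : ℝ → ℝ} (hf : ContDiff ℝ ∞ f)
    (hX : ContDiffOn ℝ ∞ X J) (hs : s ∈ J) :
    covD G c (fun r => f r • X r) s = deriv f s • X s + f s • covD G c X s := by
  have hf' : HasDerivAt f (deriv f s) s := (hf.differentiable (by simp) s).hasDerivAt
  have h1 := (hf'.smul (hasDerivAt_of_contDiffOn hc.isOpen hX hs)).deriv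
  have h2 : deriv (fun r => f r • X r) s = f s • deriv X s + deriv f s • X s := h1
  rw [covD, covD, h2, ← christoffelCLM_apply, ← christoffelCLM_apply, map_smul, smul_add]
  abel

lemma covD_congr (hc : IsCurveOn U J c) (hXY : EqOn X Y J) (hs : s ∈ J) :
    covD G c X s = covD G c Y s := by
  have h1 : X =ᶠ[𝓝 s] Y := by
    filter_upwards [hc.isOpen.mem_nhds hs] with r hr using hXY hr
  rw [covD, covD, h1.deriv_eq, hXY hs]

lemma covD_add (hc : IsCurveOn U J c) (hX : ContDiffOn ℝ ∞ X J) (hY : ContDiffOn ℝ ∞ Y J)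
    (hs : s ∈ J) :
    covD G c (fun r => X r + Y r) s = covD G c X s + covD G c Y s := by
  have h1 : deriv (fun r => X r + Y r) s = deriv X s + deriv Y s :=
    ((hasDerivAt_of_contDiffOn hc.isOpen hX hs).add
      (hasDerivAt_of_contDiffOn hc.isOpen hY hs)).deriv
  rw [covD, covD, covD, h1, ← christoffelCLM_apply, ← christoffelCLM_apply, ← christoffelCLM_apply,
    map_add]
  abel

/-- The parameters `(t, s)` for which the point `c(s) + t V(s)` lies in the coordinate domain
form an open set. -/
lemma isOpen_domain (hU : IsOpen U) (hc : IsCurveOn U J c) (hV : ContDiffOn ℝ ∞ V J) :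
    IsOpen {q : ℝ × ℝ | q.2 ∈ J ∧ c q.2 + q.1 • V q.2 ∈ U} := by
  have hcont : ContinuousOn (fun q : ℝ × ℝ => c q.2 + q.1 • V q.2) (Prod.snd ⁻¹' J) :=
    (hc.smooth.continuousOn.comp continuousOn_snd fun _ hq => hq).add
      (continuousOn_fst.smul (hV.continuousOn.comp continuousOn_snd fun _ hq => hq))
  exact hcont.isOpen_inter_preimage (hc.isOpen.preimage continuous_snd) hU

end IsCurveOn

variable [FiniteDimensional ℝ E]

lemma IsMetricOn.hasDerivAt_christoffel (h : IsMetricOn G U) {x v w : ℝ → E} {x' v' w' : E}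
    (hxU : x s ∈ U) (hx : HasDerivAt x x' s) (hv : HasDerivAt v v' s) (hw : HasDerivAt w w' s) :
    HasDerivAt (fun r => christoffel G (x r) (v r) (w r))
      (fderiv ℝ (christoffelCLM G) (x s) x' (v s) (w s) + christoffel G (x s) v' (w s)
        + christoffel G (x s) (v s) w') s := by
  have h1 : HasDerivAt (fun r => christoffelCLM G (x r))
      (fderiv ℝ (christoffelCLM G) (x s) x') s :=
    (h.differentiableAt_christoffelCLM hxU).hasFDerivAt.comp_hasDerivAt s hx
  have h2 := (h1.clm_apply hv).clm_apply hw
  simpa only [christoffelCLM_apply, _root_.add_apply] using h2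

lemma IsMetricOn.hasDerivAt_metric (h : IsMetricOn G U) {x v w : ℝ → E} {x' v' w' : E}
    (hxU : x s ∈ U) (hx : HasDerivAt x x' s) (hv : HasDerivAt v v' s) (hw : HasDerivAt w w' s) :
    HasDerivAt (fun r => G (x r) (v r) (w r))
      (G (x s) (v' + christoffel G (x s) x' (v s)) (w s)
        + G (x s) (v s) (w' + christoffel G (x s) x' (w s))) s := by
  have h1 : HasDerivAt (fun r => G (x r)) (fderiv ℝ G (x s) x') s :=
    (h.differentiableAt hxU).hasFDerivAt.comp_hasDerivAt s hx
  have h2 := (h1.clm_apply hv).clm_apply hw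
  refine h2.congr_deriv ?_
  simp only [_root_.add_apply, map_add, h.fderiv_eq hxU]
  ring

namespace IsCurveOn

lemma contDiffOn_covD (h : IsMetricOn G U) (hc : IsCurveOn U J c) (hX : ContDiffOn ℝ ∞ X J) :
    ContDiffOn ℝ ∞ (covD G c X) J := by
  refine (contDiffOn_deriv hc.isOpen hX).add ?_
  have := ((h.contDiffOn_christoffelCLM.comp hc.smooth hc.mapsTo).clm_apply
    hc.smooth_deriv).clm_apply hX
  simpa only [Function.comp_apply, christoffelCLM_apply] using this

lemma hasDerivAt_metric (h : IsMetricOn G U) (hc : IsCurveOn U J c) (hX : ContDiffOn ℝ ∞ X J)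
    (hY : ContDiffOn ℝ ∞ Y J) (hs : s ∈ J) :
    HasDerivAt (fun r => G (c r) (X r) (Y r))
      (G (c s) (covD G c X s) (Y s) + G (c s) (X s) (covD G c Y s)) s :=
  h.hasDerivAt_metric (hc.mapsTo hs) (hasDerivAt_of_contDiffOn hc.isOpen hc.smooth hs)
    (hasDerivAt_of_contDiffOn hc.isOpen hX hs) (hasDerivAt_of_contDiffOn hc.isOpen hY hs)

lemma covD_covD_smul (h : IsMetricOn G U) (hc : IsCurveOn U J c) {f : ℝ → ℝ}
    (hf : ContDiff ℝ ∞ f) (hX : ContDiffOn ℝ ∞ X J) (hs : s ∈ J) :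
    covD G c (covD G c fun r => f r • X r) s = deriv (deriv f) s • X s
      + (2 * deriv f s) • covD G c X s + f s • covD G c (covD G c X) s := by
  have hf' : ContDiff ℝ ∞ (deriv f) := by
    rw [← contDiffOn_univ] at hf ⊢
    exact contDiffOn_deriv isOpen_univ hf
  have hDX := hc.contDiffOn_covD h hX
  rw [hc.covD_congr (fun r hr => hc.covD_smul (G := G) hf hX hr) hs,
    hc.covD_add (X := fun r => deriv f r • X r) (Y := fun r => f r • covD G c X r)
      (hf'.contDiffOn.smul hX) (hf.contDiffOn.smul hDX) hs,
    hc.covD_smul hf' hX hs, hc.covD_smul hf hDX hs]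
  module

/-- The derivative of the squared tension at `t = 0`: the second covariant derivative of `V` and
the curvature appear, as the covariant derivatives in `t` and `s` do not commute. -/
lemma hasDerivAt_sqTension (h : IsMetricOn G U) (hc : IsCurveOn U J c)
    (hV : ContDiffOn ℝ ∞ V J) (hs : s ∈ J) :
    HasDerivAt (fun t => sqTension G c V t s)
      (2 * G (c s) (covD G c (deriv c) s) (covD G c (covD G c V) s
        + curvatureTensor G (c s) (V s) (deriv c s) (deriv c s))) 0 := by
  have hy := hc.mapsTo hs
  have line : ∀ a b : E, HasDerivAt (fun t : ℝ => a + t • b) b 0 := fun a b => by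
    simpa using ((hasDerivAt_id (0 : ℝ)).smul_const b).const_add a
  have hx := line (c s) (V s)
  have hv := line (deriv c s) (deriv V s)
  have hxU : c s + (0 : ℝ) • V s ∈ U := by simpa using hy
  have hτ := (line (deriv (deriv c) s) (deriv (deriv V) s)).add
    (h.hasDerivAt_christoffel hxU hx hv hv)
  have hF := h.hasDerivAt_metric hxU hx hτ hτ
  have hDV : covD G c (covD G c V) s = deriv (deriv V) s
      + (fderiv ℝ (christoffelCLM G) (c s) (deriv c s) (deriv c s) (V s)
        + christoffel G (c s) (deriv (deriv c) s) (V s)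
        + christoffel G (c s) (deriv c s) (deriv V s))
      + christoffel G (c s) (deriv c s) (covD G c V s) := by
    have h1 := (hasDerivAt_of_contDiffOn hc.isOpen (contDiffOn_deriv hc.isOpen hV) hs).add
      (h.hasDerivAt_christoffel hy (hasDerivAt_of_contDiffOn hc.isOpen hc.smooth hs)
        (hasDerivAt_of_contDiffOn hc.isOpen hc.smooth_deriv hs)
        (hasDerivAt_of_contDiffOn hc.isOpen hV hs))
    have h2 : deriv (covD G c V) s = _ := h1.deriv
    rw [covD, h2]
  refine hF.congr_deriv ?_
  simp only [Pi.add_apply, zero_smul, add_zero]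
  rw [h.symm _ hy _ (deriv (deriv c) s + _), ← two_mul]
  congr 1
  rw [covD]
  congr 1
  rw [hDV, curvatureTensor, h.fderiv_christoffel hy, h.fderiv_christoffel hy,
    h.fderiv_christoffelCLM_symm hy (deriv c s) (V s), h.christoffel_symm hy (deriv V s)]
  simp only [covD, ← christoffelCLM_apply, map_add]
  simp only [christoffelCLM_apply]
  rw [h.christoffel_symm hy (V s) (deriv (deriv c) s), h.christoffel_symm hy (V s) (deriv c s)]
  abel

lemma contDiffOn_sqTension (h : IsMetricOn G U) (hc : IsCurveOn U J c)
    (hV : ContDiffOn ℝ ∞ V J) :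
    ContDiffOn ℝ ∞ (fun q : ℝ × ℝ => sqTension G c V q.1 q.2)
      {q | q.2 ∈ J ∧ c q.2 + q.1 • V q.2 ∈ U} := by
  have hsnd : MapsTo Prod.snd {q : ℝ × ℝ | q.2 ∈ J ∧ c q.2 + q.1 • V q.2 ∈ U} J :=
    fun q hq => hq.1
  have line : ∀ {a b : ℝ → E}, ContDiffOn ℝ ∞ a J → ContDiffOn ℝ ∞ b J →
      ContDiffOn ℝ ∞ (fun q : ℝ × ℝ => a q.2 + q.1 • b q.2)
        {q | q.2 ∈ J ∧ c q.2 + q.1 • V q.2 ∈ U} := fun ha hb =>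
    (ha.comp contDiffOn_snd hsnd).add (contDiffOn_fst.smul (hb.comp contDiffOn_snd hsnd))
  have hx := line hc.smooth hV
  have hxU : MapsTo (fun q : ℝ × ℝ => c q.2 + q.1 • V q.2)
    {q | q.2 ∈ J ∧ c q.2 + q.1 • V q.2 ∈ U} U := fun q hq => hq.2
  have hV' := contDiffOn_deriv hc.isOpen hV
  have hv := line hc.smooth_deriv hV'
  have hΓ := ((h.contDiffOn_christoffelCLM.comp hx hxU).clm_apply hv).clm_apply hv
  simp only [Function.comp_apply, christoffelCLM_apply] at hΓ
  have hτ := (line (contDiffOn_deriv hc.isOpen hc.smooth_deriv)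
    (contDiffOn_deriv hc.isOpen hV')).add hΓ
  exact ((h.smooth.comp hx hxU).clm_apply hτ).clm_apply hτ

end IsCurveOn

end AlongCurves

/-! ### Tools from the calculus of variations -/

section Analysis

/-- Differentiation under the integral sign for an integrand that is continuously differentiable
near the segment `{0} × [a, b]`. -/
lemma hasDerivAt_integral_of_contDiffOn {H : ℝ × ℝ → ℝ} {O : Set (ℝ × ℝ)} (hO : IsOpen O)
    (hH : ContDiffOn ℝ 1 H O) {a b : ℝ} (hab : a ≤ b) (hsub : ∀ s ∈ Icc a b, ((0 : ℝ), s) ∈ O)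
    {H' : ℝ → ℝ} (hH' : ∀ s ∈ Icc a b, HasDerivAt (fun t => H (t, s)) (H' s) 0) :
    HasDerivAt (fun t => ∫ s in a..b, H (t, s)) (∫ s in a..b, H' s) 0 := by
  obtain ⟨u, v, hu, -, h0u, hbv, huv⟩ := generalized_tube_lemma (s := {(0 : ℝ)}) (t := Icc a b)
    isCompact_singleton isCompact_Icc hO (by rintro ⟨t, s⟩ ⟨rfl, hs⟩; exact hsub s hs)
  obtain ⟨δ, hδ, hball⟩ := Metric.nhds_basis_closedBall.mem_iff.1
    (hu.mem_nhds (h0u (mem_singleton (0 : ℝ))))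
  have hK : Metric.closedBall (0 : ℝ) δ ×ˢ Icc a b ⊆ O := fun q hq =>
    huv ⟨hball hq.1, hbv hq.2⟩
  have hd : ∀ q ∈ O, HasDerivAt (fun t => H (t, q.2)) (fderiv ℝ H q (1, 0)) q.1 := by
    rintro ⟨t, s⟩ hq
    have h1 : HasFDerivAt H (fderiv ℝ H (t, s)) (t, s) :=
      ((hH.contDiffAt (hO.mem_nhds hq)).differentiableAt (by simp)).hasFDerivAt
    exact h1.comp_hasDerivAt t ((hasDerivAt_id t).prodMk (hasDerivAt_const t s))
  have hcont : ContinuousOn (fun q => fderiv ℝ H q (1, 0)) O :=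
    (hH.continuousOn_fderiv_of_isOpen hO le_rfl).clm_apply continuousOn_const
  obtain ⟨C, hC⟩ := ((isCompact_closedBall (0 : ℝ) δ).prod
    isCompact_Icc).exists_bound_of_continuousOn (hcont.mono hK)
  have hs : ∀ t ∈ Metric.closedBall (0 : ℝ) δ, ∀ {f : ℝ × ℝ → ℝ}, ContinuousOn f O →
      ContinuousOn (fun s => f (t, s)) (uIcc a b) := by
    intro t ht f hf
    rw [uIcc_of_le hab]
    exact hf.comp (by fun_prop) fun s hs => hK ⟨ht, hs⟩
  have h0 : (0 : ℝ) ∈ Metric.closedBall (0 : ℝ) δ := Metric.mem_closedBall_self hδ.le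
  have hint : ∀ {f : ℝ × ℝ → ℝ}, ContinuousOn f O → ∀ t ∈ Metric.closedBall (0 : ℝ) δ,
      IntervalIntegrable (fun s => f (t, s)) volume a b := fun hf t ht =>
    (hs t ht hf).intervalIntegrable
  have hmem : ∀ {s}, s ∈ uIoc a b → s ∈ Icc a b := fun hs =>
    Ioc_subset_Icc_self (by rwa [uIoc_of_le hab] at hs)
  have key := (intervalIntegral.hasDerivAt_integral_of_dominated_loc_of_deriv_le
    (F := fun t s => H (t, s)) (F' := fun t s => fderiv ℝ H (t, s) (1, 0)) (μ := volume)
    (bound := fun _ => C) (a := a) (b := b) (x₀ := (0 : ℝ))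
    (s := Metric.closedBall (0 : ℝ) δ) (Metric.closedBall_mem_nhds _ hδ)
    (by
      filter_upwards [Metric.closedBall_mem_nhds (0 : ℝ) hδ] with t ht
      exact (hint hH.continuousOn t ht).def'.aestronglyMeasurable)
    (hint hH.continuousOn 0 h0) (hint hcont 0 h0).def'.aestronglyMeasurable
    (Filter.Eventually.of_forall fun s hs t ht => hC (t, s) ⟨ht, hmem hs⟩)
    intervalIntegrable_const
    (Filter.Eventually.of_forall fun s hs t ht => hd (t, s) (hK ⟨ht, hmem hs⟩))).2
  refine key.congr_deriv (intervalIntegral.integral_congr fun s hs => ?_)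
  rw [uIcc_of_le hab] at hs
  exact (hd (0, s) (hsub s hs)).unique (hH' s hs)

/-- A form of the fundamental lemma of the calculus of variations for bump functions. -/
lemma eq_zero_of_integral_bump_mul_eq_zero {J : Set ℝ} (hJ : IsOpen J) {h : ℝ → ℝ}
    (hh : ContinuousOn h J)
    (hint : ∀ a b, a < b → Icc a b ⊆ J → ∀ f : ℝ → ℝ, ContDiff ℝ ∞ f → (∀ s, 0 ≤ f s) →
      (∀ s, s ∉ Ioo a b → f s = 0) → ∫ s in a..b, f s * h s = 0) :
    ∀ s ∈ J, h s = 0 := by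
  have main : ∀ k : ℝ → ℝ, ContinuousOn k J →
      (∀ a b, a < b → Icc a b ⊆ J → ∀ f : ℝ → ℝ, ContDiff ℝ ∞ f → (∀ s, 0 ≤ f s) →
        (∀ s, s ∉ Ioo a b → f s = 0) → ∫ s in a..b, f s * k s = 0) →
      ∀ s ∈ J, ¬ 0 < k s := by
    intro k hk hint s hs hpos
    have hev : ∀ᶠ r in 𝓝 s, r ∈ J ∧ 0 < k r :=
      Filter.Eventually.and (hJ.mem_nhds hs)
        ((hk.continuousAt (hJ.mem_nhds hs)).eventually (lt_mem_nhds hpos))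
    obtain ⟨δ, hδ, hball⟩ := Metric.nhds_basis_closedBall.mem_iff.1 hev
    rw [Real.closedBall_eq_Icc] at hball
    let f : ContDiffBump s := ⟨δ / 2, δ, by linarith, by linarith⟩
    have hsupp : ∀ r, r ∈ Ioo (s - δ) (s + δ) ↔ f r ≠ 0 := fun r => by
      rw [← Function.mem_support, f.support_eq, Real.ball_eq_Ioo]
    have h0 := hint (s - δ) (s + δ) (by linarith) (fun r hr => (hball hr).1) f f.contDiff
      (fun r => f.nonneg) (fun r hr => by_contra fun h => hr ((hsupp r).2 h))
    have hle : s - δ ≤ s + δ := by linarith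
    refine (intervalIntegral.intervalIntegral_pos_of_pos_on (f := fun r => f r * k r) ?_ ?_
      (by linarith)).ne' h0
    · refine ContinuousOn.intervalIntegrable ?_
      rw [uIcc_of_le hle]
      exact f.continuous.continuousOn.mul (hk.mono fun r hr => (hball hr).1)
    · intro r hr
      exact mul_pos (f.nonneg.lt_of_ne' ((hsupp r).1 hr)) (hball (Ioo_subset_Icc_self hr)).2
  intro s hs
  refine le_antisymm (not_lt.1 (main h hh hint s hs)) (neg_nonpos.1 (not_lt.1 ?_))
  refine main (fun r => - h r) hh.neg (fun a b hab hsub f h1 h2 h3 => ?_) s hs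
  simp only [mul_neg, intervalIntegral.integral_neg, hint a b hab hsub f h1 h2 h3, neg_zero]

/-- The derivative of a function on `J` that vanishes at both ends of `[a, b] ⊆ J` has
integral zero. -/
lemma integral_deriv_eq_zero {J : Set ℝ} (hJ : IsOpen J) {u : ℝ → ℝ} (hu : ContDiffOn ℝ ∞ u J)
    {a b : ℝ} (hab : a ≤ b) (hsub : Icc a b ⊆ J) (ha : u a = 0) (hb : u b = 0) :
    ∫ s in a..b, deriv u s = 0 := by
  rw [← uIcc_of_le hab] at hsub
  rw [intervalIntegral.integral_deriv_eq_sub, ha, hb, sub_zero]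
  · exact fun s hs => (hu.contDiffAt (hJ.mem_nhds (hsub hs))).differentiableAt (by simp)
  · exact ((hu.continuousOn_deriv_of_isOpen hJ (by simp)).mono hsub).intervalIntegrable

end Analysis

/-! ### Critical curves in coordinates -/

section CriticalCurves

variable {E : Type*} [NormedAddCommGroup E] [NormedSpace ℝ E]
variable {G : E → E →L[ℝ] E →L[ℝ] ℝ} {U : Set E} {J : Set ℝ} {c : ℝ → E} {p : ℝ}

lemma IsMetricOn.apply_curvatureTensor_nonpos (h : IsMetricOn G U)
    (hcurv : ∀ y ∈ U, ∀ v w : E, LinearIndependent ℝ ![v, w] → sectionalCurvature G y v w ≤ 0)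
    {y v w : E} (hy : y ∈ U) (hv : v ≠ 0) (hw : w ≠ 0) (hvw : G y v w = 0) :
    G y v (curvatureTensor G y v w w) ≤ 0 := by
  have hvv := h.pos y hy v hv
  have hww := h.pos y hy w hw
  have hli : LinearIndependent ℝ ![v, w] := by
    rw [LinearIndependent.pair_iff]
    intro s t hst
    have h1 : G y v (s • v + t • w) = 0 := by rw [hst, map_zero]
    have h2 : G y (s • v + t • w) w = 0 := by rw [hst, map_zero, _root_.zero_apply]
    simp only [map_add, map_smul, _root_.add_apply, _root_.smul_apply, smul_eq_mul, hvw,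
      mul_zero, add_zero, zero_add, mul_eq_zero, hvv.ne', hww.ne', or_false] at h1 h2
    exact ⟨h1, h2⟩
  have h1 := hcurv y hy v w hli
  rw [sectionalCurvature, hvw, div_nonpos_iff] at h1
  rw [h.symm y hy]
  have : 0 < G y v v * G y w w := mul_pos hvv hww
  rcases h1 with h1 | h1
  · linarith [h1.2]
  · exact h1.1

variable [FiniteDimensional ℝ E]

lemma IsMetricOn.curvatureTensor_smul (h : IsMetricOn G U) {y : E} (hy : y ∈ U) (a : ℝ)
    (X Y Z : E) : curvatureTensor G y (a • X) Y Z = a • curvatureTensor G y X Y Z := by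
  rw [curvatureTensor, curvatureTensor, h.fderiv_christoffel hy, h.fderiv_christoffel hy,
    h.fderiv_christoffel hy, h.fderiv_christoffel hy]
  simp only [← christoffelCLM_apply, map_smul, _root_.smul_apply]
  module

lemma IsCurveOn.contDiffOn_curvatureTensor (h : IsMetricOn G U) (hc : IsCurveOn U J c)
    {X Y : ℝ → E} (hX : ContDiffOn ℝ ∞ X J) (hY : ContDiffOn ℝ ∞ Y J) :
    ContDiffOn ℝ ∞ (fun s => curvatureTensor G (c s) (X s) (Y s) (Y s)) J := by
  have hD := (h.contDiffOn_christoffelCLM.fderiv_of_isOpen h.isOpen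
    (m := ∞) (by simp)).comp hc.smooth hc.mapsTo
  have hΓ := h.contDiffOn_christoffelCLM.comp hc.smooth hc.mapsTo
  have hΓ' : ∀ {A B : ℝ → E}, ContDiffOn ℝ ∞ A J → ContDiffOn ℝ ∞ B J →
      ContDiffOn ℝ ∞ (fun s => christoffel G (c s) (A s) (B s)) J := fun hA hB => by
    simpa only [Function.comp_apply, christoffelCLM_apply] using
      (hΓ.clm_apply hA).clm_apply hB
  refine ContDiffOn.congr (((((hD.clm_apply hX).clm_apply hY).clm_apply hY).add
    (hΓ' hX (hΓ' hY hY))).sub ((((hD.clm_apply hY).clm_apply hX).clm_apply hY).add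
    (hΓ' hY (hΓ' hX hY)))) fun s hs => ?_
  have hy := hc.mapsTo hs
  rw [curvatureTensor, h.fderiv_christoffel hy, h.fderiv_christoffel hy]
  rfl


/-- The first variation of the energy vanishes on the variation `c + t V` of a critical curve. The
assumption `|τ|² > 0` makes the power `|τ|^p = (|τ|²)^(p / 2)` differentiable for every `p`. -/
lemma IsCurveOn.integral_firstVariation_eq_zero (h : IsMetricOn G U) (hc : IsCurveOn U J c)
    (hp : 0 < p) {a b : ℝ} (hab : a ≤ b) (hsub : Icc a b ⊆ J) {V : ℝ → E}
    (hV : ContDiffOn ℝ ∞ V J)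
    (hpos : ∀ s ∈ J, 0 < G (c s) (covD G c (deriv c) s) (covD G c (deriv c) s))
    (hcrit : HasDerivAt (fun t => 1 / p * ∫ s in a..b, sqTension G c V t s ^ (p / 2)) 0 0) :
    ∫ s in a..b, G (c s) (covD G c (deriv c) s) (covD G c (deriv c) s) ^ (p / 2 - 1)
      * G (c s) (covD G c (deriv c) s) (covD G c (covD G c V) s
        + curvatureTensor G (c s) (V s) (deriv c s) (deriv c s)) = 0 := by
  set O : Set (ℝ × ℝ) := {q | q.2 ∈ J ∧ c q.2 + q.1 • V q.2 ∈ U} with hOdef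
  have hO : IsOpen O := hc.isOpen_domain h.isOpen hV
  have hF := hc.contDiffOn_sqTension h hV
  set O' : Set (ℝ × ℝ) := O ∩ (fun q : ℝ × ℝ => sqTension G c V q.1 q.2) ⁻¹' Ioi 0 with hO'def
  have hO' : IsOpen O' := hF.continuousOn.isOpen_inter_preimage hO isOpen_Ioi
  have hH : ContDiffOn ℝ 1 (fun q : ℝ × ℝ => sqTension G c V q.1 q.2 ^ (p / 2)) O' :=
    ((hF.of_le (by simp)).mono inter_subset_left).rpow_const_of_ne fun q hq => (ne_of_gt hq.2)
  have hmem : ∀ s ∈ Icc a b, ((0 : ℝ), s) ∈ O' := by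
    intro s hs
    refine ⟨⟨hsub hs, ?_⟩, ?_⟩
    · simpa using hc.mapsTo (hsub hs)
    · simpa [sqTension_zero] using hpos s (hsub hs)
  have hD := (hasDerivAt_integral_of_contDiffOn hO' hH hab hmem (H' := fun s =>
    p * (G (c s) (covD G c (deriv c) s) (covD G c (deriv c) s) ^ (p / 2 - 1)
      * G (c s) (covD G c (deriv c) s) (covD G c (covD G c V) s
        + curvatureTensor G (c s) (V s) (deriv c s) (deriv c s)))) ?_).const_mul (1 / p)
  · have h0 := hD.unique hcrit
    rw [intervalIntegral.integral_const_mul, ← mul_assoc, one_div_mul_cancel hp.ne', one_mul] at h0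
    exact h0
  · intro s hs
    have h1 := (hc.hasDerivAt_sqTension h hV (hsub hs)).rpow_const (p := p / 2)
      (Or.inl (by rw [sqTension_zero]; exact (hpos s (hsub hs)).ne'))
    refine h1.congr_deriv ?_
    rw [sqTension_zero]
    ring

/-- In non-positive curvature, a unit speed curve whose tension vanishes nowhere is not critical
for the energy `(1 / p) ∫ |τ|^p` (with constant `|τ|` if `p = 1 / 2`). -/
theorem IsCurveOn.not_critical (h : IsMetricOn G U) (hc : IsCurveOn U J c) (hJ : J.Nonempty)
    (hp : 0 < p)
    (hcurv : ∀ y ∈ U, ∀ v w : E, LinearIndependent ℝ ![v, w] → sectionalCurvature G y v w ≤ 0)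
    (hunit : ∀ s ∈ J, G (c s) (deriv c s) (deriv c s) = 1)
    (hpos : ∀ s ∈ J, 0 < G (c s) (covD G c (deriv c) s) (covD G c (deriv c) s))
    (hcrit : ∀ a b, a < b → Icc a b ⊆ J → ∀ V : ℝ → E, ContDiffOn ℝ ∞ V J →
      (∀ s, s ∉ Ioo a b → V s = 0) →
      HasDerivAt (fun t => 1 / p * ∫ s in a..b, sqTension G c V t s ^ (p / 2)) 0 0)
    (hhalf : p = 1 / 2 → ∃ C, ∀ s ∈ J,
      G (c s) (covD G c (deriv c) s) (covD G c (deriv c) s) = C) : False := by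
  set T := deriv c with hTdef
  set τ := covD G c T with hτdef
  set κ : ℝ → ℝ := fun s => G (c s) (τ s) (τ s) with hκdef
  have hT : ContDiffOn ℝ ∞ T J := hc.smooth_deriv
  have hτ : ContDiffOn ℝ ∞ τ J := hc.contDiffOn_covD h hT
  have hDτ : ContDiffOn ℝ ∞ (covD G c τ) J := hc.contDiffOn_covD h hτ
  have hκ : ContDiffOn ℝ ∞ κ J := hc.contDiffOn_metric h hτ hτ
  have hκpow : ∀ r : ℝ, ContDiffOn ℝ ∞ (fun s => κ s ^ r) J := fun r =>
    hκ.rpow_const_of_ne fun s hs => (hpos s hs).ne'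
  have hκ' : ∀ s ∈ J, deriv κ s = 2 * G (c s) (τ s) (covD G c τ s) := fun s hs => by
    rw [(hc.hasDerivAt_metric h hτ hτ hs).deriv, h.symm _ (hc.mapsTo hs) (covD G c τ s)]
    ring
  -- Differentiating a function that is constant on `J`.
  have hconst : ∀ {u : ℝ → ℝ} {k : ℝ}, (∀ s ∈ J, u s = k) → ∀ s ∈ J, deriv u s = 0 := by
    intro u k hu s hs
    have : u =ᶠ[𝓝 s] fun _ => k := by
      filter_upwards [hc.isOpen.mem_nhds hs] with r hr using hu r hr
    rw [this.deriv_eq, deriv_const]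
  have hτT : ∀ s ∈ J, G (c s) (τ s) (T s) = 0 := fun s hs => by
    have h1 := (hc.hasDerivAt_metric h hT hT hs).deriv
    rw [hconst hunit s hs, h.symm _ (hc.mapsTo hs) (T s)] at h1
    linarith
  have hDτT : ∀ s ∈ J, G (c s) (covD G c τ s) (T s) = - κ s := fun s hs => by
    have h1 := (hc.hasDerivAt_metric h hτ hT hs).deriv
    rw [hconst hτT s hs] at h1
    have h2 : G (c s) (τ s) (covD G c T s) = κ s := rfl
    linarith
  have hpow : ∀ s ∈ J, κ s ^ (p / 2 - 1) * κ s = κ s ^ (p / 2) := fun s hs => by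
    rw [← Real.rpow_add_one (hpos s hs).ne', sub_add_cancel]
  have hpow0 : ∀ r : ℝ, ∀ s ∈ J, κ s ^ r ≠ 0 := fun r s hs =>
    (Real.rpow_pos_of_pos (hpos s hs) r).ne'
  have firstVariation : ∀ a b, a < b → Icc a b ⊆ J → ∀ V : ℝ → E, ContDiffOn ℝ ∞ V J →
      (∀ s, s ∉ Ioo a b → V s = 0) → ∫ s in a..b, κ s ^ (p / 2 - 1)
        * G (c s) (τ s) (covD G c (covD G c V) s
          + curvatureTensor G (c s) (V s) (T s) (T s)) = 0 := fun a b hab hsub V hV hV0 =>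
    hc.integral_firstVariation_eq_zero h hp hab.le hsub hV hpos (hcrit a b hab hsub V hV hV0)
  -- The tangential part of the Euler-Lagrange equation: `|τ|` is constant.
  have hκ0 : ∀ s ∈ J, deriv κ s = 0 := by
    by_cases hp2 : p = 1 / 2
    · obtain ⟨C, hC⟩ := hhalf hp2
      exact hconst hC
    have hzero : ∀ s ∈ J, (1 / 2 - p) * (κ s ^ (p / 2 - 1) * deriv κ s) = 0 := by
      refine eq_zero_of_integral_bump_mul_eq_zero hc.isOpen ?_ ?_
      · exact continuousOn_const.mul ((hκpow _).continuousOn.mul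
          (contDiffOn_deriv hc.isOpen hκ).continuousOn)
      intro a b hab hsub f hf _ hf0
      have hV : ContDiffOn ℝ ∞ (fun s => f s • T s) J := hf.contDiffOn.smul hT
      have h0 := firstVariation a b hab hsub _ hV fun s hs => by rw [hf0 s hs, zero_smul]
      have hu : ContDiffOn ℝ ∞ (fun s => f s * κ s ^ (p / 2)) J := hf.contDiffOn.mul (hκpow _)
      have h1 := integral_deriv_eq_zero hc.isOpen hu hab.le hsub
        (by rw [hf0 a (by simp), zero_mul]) (by rw [hf0 b (by simp), zero_mul])
      have hint : ∀ {u : ℝ → ℝ}, ContDiffOn ℝ ∞ u J → IntervalIntegrable u volume a b :=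
        fun hu => ContinuousOn.intervalIntegrable (by
          rw [uIcc_of_le hab.le]; exact hu.continuousOn.mono hsub)
      have hw : ContDiffOn ℝ ∞ (fun s => f s * ((1 / 2 - p) * (κ s ^ (p / 2 - 1) * deriv κ s))) J :=
        hf.contDiffOn.mul (contDiffOn_const.mul ((hκpow _).mul (contDiffOn_deriv hc.isOpen hκ)))
      -- The curvature term vanishes, as `R(T, T) = 0`, and the rest of the integrand is a
      -- derivative up to a multiple of `f`.
      have h2 : (∫ s in a..b, (2 * deriv (fun s => f s * κ s ^ (p / 2)) s
          + f s * ((1 / 2 - p) * (κ s ^ (p / 2 - 1) * deriv κ s)))) = 0 := by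
        rw [← h0]
        refine intervalIntegral.integral_congr fun s hs => ?_
        rw [uIcc_of_le hab.le] at hs
        have hsJ := hsub hs
        have hfs : HasDerivAt f (deriv f s) s := (hf.differentiable (by simp) s).hasDerivAt
        have hd := (hfs.mul ((hasDerivAt_of_contDiffOn hc.isOpen hκ hsJ).rpow_const
          (p := p / 2) (Or.inl (hpos s hsJ).ne'))).deriv
        have hd' : deriv (fun s => f s * κ s ^ (p / 2)) s = deriv f s * κ s ^ (p / 2)
          + f s * (deriv κ s * (p / 2) * κ s ^ (p / 2 - 1)) := hd
        have hR : curvatureTensor G (c s) (f s • T s) (T s) (T s) = 0 := by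
          rw [h.curvatureTensor_smul (hc.mapsTo hsJ), curvatureTensor, sub_self, smul_zero]
        have hcov := hc.covD_covD_smul h hf hT hsJ
        simp only [hR, hcov, add_zero, map_add, map_smul, smul_eq_mul]
        rw [hτT s hsJ, show G (c s) (τ s) (covD G c T s) = κ s from rfl,
          show G (c s) (τ s) (covD G c (covD G c T) s) = deriv κ s / 2 from by
            rw [hκ' s hsJ]; ring,
          hd', ← hpow s hsJ]
        ring
      rw [intervalIntegral.integral_add ((hint (contDiffOn_deriv hc.isOpen hu)).const_mul 2)
        (hint hw), intervalIntegral.integral_const_mul, h1, mul_zero, zero_add] at h2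
      exact h2
    intro s hs
    have h1 := hzero s hs
    have h2 : (1 / 2 - p) ≠ 0 := fun h => hp2 (by linarith)
    exact ((mul_eq_zero.1 ((mul_eq_zero.1 h1).resolve_left h2)).resolve_left (hpow0 _ s hs))
  -- The component along `τ`: both `- |∇τ|²` and the curvature term are non-positive.
  have hzero : ∀ s ∈ J, κ s ^ (p / 2 - 1) * (- G (c s) (covD G c τ s) (covD G c τ s)
      + G (c s) (τ s) (curvatureTensor G (c s) (τ s) (T s) (T s))) = 0 := by
    have hR : ContDiffOn ℝ ∞ (fun s => κ s ^ (p / 2 - 1) * (- G (c s) (covD G c τ s) (covD G c τ s)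
        + G (c s) (τ s) (curvatureTensor G (c s) (τ s) (T s) (T s)))) J :=
      (hκpow _).mul ((hc.contDiffOn_metric h hDτ hDτ).neg.add
        (hc.contDiffOn_metric h hτ (hc.contDiffOn_curvatureTensor h hτ hT)))
    refine eq_zero_of_integral_bump_mul_eq_zero hc.isOpen hR.continuousOn ?_
    intro a b hab hsub f hf hf1 hf0
    have hV : ContDiffOn ℝ ∞ (fun s => f s • τ s) J := hf.contDiffOn.smul hτ
    have h0 := firstVariation a b hab hsub _ hV fun s hs => by rw [hf0 s hs, zero_smul]
    have hf' : ContDiff ℝ ∞ (deriv f) :=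
      contDiffOn_univ.1 (contDiffOn_deriv isOpen_univ hf.contDiffOn)
    have hu : ContDiffOn ℝ ∞ (fun s => deriv f s * κ s ^ (p / 2)) J :=
      hf'.contDiffOn.mul (hκpow _)
    -- The zeros of the nonnegative function `f` are minima.
    have hf'0 : ∀ s, f s = 0 → deriv f s = 0 := fun s hs =>
      IsLocalMin.deriv_eq_zero (Filter.Eventually.of_forall fun r => by
        change f s ≤ f r
        rw [hs]; exact hf1 r)
    have h1 := integral_deriv_eq_zero hc.isOpen hu hab.le hsub
      (by rw [hf'0 a (hf0 a (by simp)), zero_mul]) (by rw [hf'0 b (hf0 b (by simp)), zero_mul])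
    have hint : ∀ {u : ℝ → ℝ}, ContDiffOn ℝ ∞ u J → IntervalIntegrable u volume a b :=
      fun hu => ContinuousOn.intervalIntegrable (by
        rw [uIcc_of_le hab.le]; exact hu.continuousOn.mono hsub)
    have hw := hf.contDiffOn.mul hR
    -- As `κ` is constant, the term `f'' κ ^ (p / 2)` of the integrand is a derivative.
    have h2 : (∫ s in a..b, (deriv (fun s => deriv f s * κ s ^ (p / 2)) s
        + f s * (κ s ^ (p / 2 - 1) * (- G (c s) (covD G c τ s) (covD G c τ s)
          + G (c s) (τ s) (curvatureTensor G (c s) (τ s) (T s) (T s)))))) = 0 := by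
      rw [← h0]
      refine intervalIntegral.integral_congr fun s hs => ?_
      rw [uIcc_of_le hab.le] at hs
      have hsJ := hsub hs
      have hfs : HasDerivAt (deriv f) (deriv (deriv f) s) s :=
        (hf'.differentiable (by simp) s).hasDerivAt
      have hd := (hfs.mul ((hasDerivAt_of_contDiffOn hc.isOpen hκ hsJ).rpow_const
        (p := p / 2) (Or.inl (hpos s hsJ).ne'))).deriv
      have hd' : deriv (fun s => deriv f s * κ s ^ (p / 2)) s = deriv (deriv f) s * κ s ^ (p / 2)
        + deriv f s * (deriv κ s * (p / 2) * κ s ^ (p / 2 - 1)) := hd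
      have hRf : curvatureTensor G (c s) (f s • τ s) (T s) (T s)
          = f s • curvatureTensor G (c s) (τ s) (T s) (T s) :=
        h.curvatureTensor_smul (hc.mapsTo hsJ) _ _ _ _
      have hcov := hc.covD_covD_smul h hf hτ hsJ
      have hττ : G (c s) (τ s) (covD G c τ s) = 0 := by
        have := hκ' s hsJ
        rw [hκ0 s hsJ] at this
        linarith
      have hτττ : G (c s) (τ s) (covD G c (covD G c τ) s)
          = - G (c s) (covD G c τ s) (covD G c τ s) := by
        have h3 := (hc.hasDerivAt_metric h hτ hDτ hsJ).deriv
        rw [hconst (u := fun r => G (c r) (τ r) (covD G c τ r)) (k := 0) (fun r hr => by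
          have := hκ' r hr
          rw [hκ0 r hr] at this
          linarith) s hsJ] at h3
        linarith
      simp only [hRf, hcov, map_add, map_smul, smul_eq_mul]
      rw [hττ, hτττ, show G (c s) (τ s) (τ s) = κ s from rfl, hd', hκ0 s hsJ, ← hpow s hsJ]
      ring
    rw [intervalIntegral.integral_add (hint (contDiffOn_deriv hc.isOpen hu)) (hint hw), h1,
      zero_add] at h2
    exact h2
  obtain ⟨s, hs⟩ := hJ
  have hy := hc.mapsTo hs
  have hτ0 : τ s ≠ 0 := fun h0 => (hpos s hs).ne' (by rw [h0]; simp)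
  have hT0 : T s ≠ 0 := fun h0 => by
    have := hunit s hs
    rw [h0] at this
    simp at this
  have h1 := h.apply_curvatureTensor_nonpos hcurv hy hτ0 hT0 (hτT s hs)
  have h2 : - G (c s) (covD G c τ s) (covD G c τ s)
      + G (c s) (τ s) (curvatureTensor G (c s) (τ s) (T s) (T s)) = 0 := by
    exact (mul_eq_zero.1 (hzero s hs)).resolve_left (hpow0 _ s hs)
  have h3 : covD G c τ s = 0 := by
    by_contra hne
    linarith [h.pos _ hy _ hne]
  have h4 := hDτT s hs
  rw [h3, map_zero, _root_.zero_apply] at h4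
  linarith [hpos s hs]

end CriticalCurves

/-! ### The metric in charts -/

section Charts

variable {n : ℕ} {M : Type*} [TopologicalSpace M] [ChartedSpace (Model n) M]
  {e e' : OpenPartialHomeomorph M (Model n)} {x : M}

section

variable [IsManifold (𝓡 n) ∞ M]

lemma contMDiffOn_chart (he : e ∈ atlas (Model n) M) :
    ContMDiffOn (𝓡 n) 𝓘(ℝ, Model n) ∞ e e.source :=
  contMDiffOn_of_mem_maximalAtlas (IsManifold.subset_maximalAtlas he)

lemma contMDiffOn_chart_symm (he : e ∈ atlas (Model n) M) :
    ContMDiffOn 𝓘(ℝ, Model n) (𝓡 n) ∞ e.symm e.target :=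
  contMDiffOn_symm_of_mem_maximalAtlas (IsManifold.subset_maximalAtlas he)

lemma mdifferentiable_chart_of_mem_atlas (he : e ∈ atlas (Model n) M) :
    e.MDifferentiable (𝓡 n) 𝓘(ℝ, Model n) :=
  have : IsManifold (𝓡 n) 1 M := IsManifold.of_le (n := ∞) (by simp)
  mdifferentiable_of_mem_atlas he

lemma isInvertible_mfderiv_chart (he : e ∈ atlas (Model n) M) (hx : x ∈ e.source) :
    (mfderiv (𝓡 n) 𝓘(ℝ, Model n) e x).IsInvertible :=
  ⟨(mdifferentiable_chart_of_mem_atlas he).mfderiv hx, rfl⟩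

lemma ofCoord_mfderiv (he : e ∈ atlas (Model n) M) (hx : x ∈ e.source)
    (v : TangentSpace (𝓡 n) x) : ofCoord e x (mfderiv (𝓡 n) 𝓘(ℝ, Model n) e x v) = v :=
  (isInvertible_mfderiv_chart he hx).inverse_apply_self v

lemma mfderiv_ofCoord (he : e ∈ atlas (Model n) M) (hx : x ∈ e.source) (v : Model n) :
    mfderiv (𝓡 n) 𝓘(ℝ, Model n) e x (ofCoord e x v) = v :=
  (isInvertible_mfderiv_chart he hx).self_apply_inverse v

lemma ofCoord_eq_zero_iff (he : e ∈ atlas (Model n) M) (hx : x ∈ e.source) {v : Model n} :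
    ofCoord e x v = 0 ↔ v = 0 := by
  refine ⟨fun h => ?_, fun h => by rw [h, map_zero]⟩
  rw [← mfderiv_ofCoord he hx v, h, map_zero]
  rfl

lemma ofCoord_symm (he : e ∈ atlas (Model n) M) {y : Model n} (hy : y ∈ e.target)
    (v : Model n) : ofCoord e (e.symm y) v = mfderiv 𝓘(ℝ, Model n) (𝓡 n) e.symm y v := by
  have h1 := (mdifferentiable_chart_of_mem_atlas he).comp_symm_deriv hy
  have h2 := DFunLike.congr_fun h1 v
  have h3 := ofCoord_mfderiv he (e.map_target hy) (mfderiv 𝓘(ℝ, Model n) (𝓡 n) e.symm y v)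
  rw [← h3]
  congr 1
  exact h2.symm

/-- The coordinate change between two charts. -/
lemma contDiffOn_coordChange (he : e ∈ atlas (Model n) M) (he' : e' ∈ atlas (Model n) M) :
    ContDiffOn ℝ ∞ (fun y => e' (e.symm y)) (e.symm.trans e').source := by
  rw [← contMDiffOn_iff_contDiffOn]
  refine (contMDiffOn_chart he').comp ((contMDiffOn_chart_symm he).mono ?_) ?_
  · intro y hy; rw [OpenPartialHomeomorph.trans_source] at hy; exact hy.1
  · intro y hy; rw [OpenPartialHomeomorph.trans_source] at hy; exact hy.2

lemma ofCoord_fderiv_coordChange (he : e ∈ atlas (Model n) M) (he' : e' ∈ atlas (Model n) M)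
    (hx : x ∈ e.source) (hx' : x ∈ e'.source) (v : Model n) :
    ofCoord e' x (fderiv ℝ (fun y => e' (e.symm y)) (e x) v) = ofCoord e x v := by
  have hy := e.map_source hx
  obtain ⟨y, hyt, rfl⟩ : ∃ y ∈ e.target, e.symm y = x := ⟨e x, hy, e.left_inv hx⟩
  rw [e.right_inv hyt, ofCoord_symm he hyt, ← mfderiv_eq_fderiv]
  have h1 : mfderiv 𝓘(ℝ, Model n) 𝓘(ℝ, Model n) (e' ∘ e.symm) y =
      (mfderiv (𝓡 n) 𝓘(ℝ, Model n) e' (e.symm y)).comp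
        (mfderiv 𝓘(ℝ, Model n) (𝓡 n) e.symm y) :=
    mfderiv_comp y ((mdifferentiable_chart_of_mem_atlas he').mdifferentiableAt hx')
      ((mdifferentiable_chart_of_mem_atlas he).mdifferentiableAt_symm hyt)
  have h2 := ofCoord_mfderiv he' hx' (mfderiv 𝓘(ℝ, Model n) (𝓡 n) e.symm y v)
  rw [← h2]
  congr 1
  exact DFunLike.congr_fun h1 v

end

variable [RiemannianBundle (fun x : M => TangentSpace (𝓡 n) x)]

lemma metricInChart_apply (e : OpenPartialHomeomorph M (Model n)) (y v w : Model n) :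
    metricInChart e y v w = inner ℝ (ofCoord e (e.symm y) v) (ofCoord e (e.symm y) w) := rfl

lemma inner_ofCoord (hx : x ∈ e.source) (v w : Model n) :
    inner ℝ (ofCoord e x v) (ofCoord e x w) = metricInChart e (e x) v w := by
  rw [metricInChart_apply, e.left_inv hx]

lemma sq_norm_ofCoord (hx : x ∈ e.source) (v : Model n) :
    ‖ofCoord e x v‖ ^ 2 = metricInChart e (e x) v v := by
  rw [← inner_ofCoord hx, real_inner_self_eq_norm_sq]

variable [IsManifold (𝓡 n) ∞ M]

lemma isMetricOn_metricInChart [IsContMDiffRiemannianBundle (𝓡 n) ∞ (Model n)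
      (fun x : M => TangentSpace (𝓡 n) x)] (he : e ∈ atlas (Model n) M) :
    IsMetricOn (metricInChart e) e.target where
  isOpen := e.open_target
  smooth := by
    rw [contDiffOn_clm_apply]
    intro v
    rw [contDiffOn_clm_apply]
    intro w
    rw [← contMDiffOn_iff_contDiffOn]
    have hsec : ∀ v : Model n, ContMDiffOn 𝓘(ℝ, Model n) ((𝓡 n).prod 𝓘(ℝ, Model n)) ∞
        (fun y => (⟨e.symm y, ofCoord e (e.symm y) v⟩ : TotalSpace (Model n)
          (fun x : M => TangentSpace (𝓡 n) x))) e.target := by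
      intro v
      have : IsManifold (𝓡 n) 1 M := IsManifold.of_le (n := ∞) (by simp)
      have h1 := (contMDiffOn_chart_symm he).contMDiffOn_tangentMapWithin (m := ∞) (by simp)
        e.open_target.uniqueMDiffOn
      have h2 : ContMDiffOn 𝓘(ℝ, Model n) 𝓘(ℝ, Model n).tangent ∞
          (fun y : Model n => (⟨y, v⟩ : TangentBundle 𝓘(ℝ, Model n) (Model n))) e.target := by
        have := (contMDiffOn_vectorSpace_iff_contDiffOn (𝕜 := ℝ) (n := ∞) (s := e.target)
          (V := fun y : Model n => (v : TangentSpace 𝓘(ℝ, Model n) y))).2 contDiffOn_const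
        exact this
      refine (h1.comp h2 fun y hy => hy).congr fun y hy => ?_
      rw [Function.comp_apply, tangentMapWithin, mfderivWithin_of_isOpen e.open_target hy,
        ofCoord_symm he hy]
    exact ContMDiffOn.inner_bundle (hsec v) (hsec w)
  symm y hy v w := by
    rw [metricInChart_apply, metricInChart_apply, real_inner_comm]
  pos y hy v hv := by
    rw [metricInChart_apply]
    refine real_inner_self_pos.2 fun h0 => hv ?_
    exact (ofCoord_eq_zero_iff he (e.map_target hy)).1 h0

end Charts

/-! ### The tension of a curve in charts -/

section Curves

variable {n : ℕ} {M : Type*} [TopologicalSpace M] [ChartedSpace (Model n) M]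
  [IsManifold (𝓡 n) ∞ M]
  {e : OpenPartialHomeomorph M (Model n)} {γ : ℝ → M} {I : Set ℝ} {s : ℝ}

lemma contDiffAt_chart_comp (he : e ∈ atlas (Model n) M)
    (hγ : ContMDiffAt 𝓘(ℝ, ℝ) (𝓡 n) ∞ γ s) (hs : γ s ∈ e.source) :
    ContDiffAt ℝ ∞ (fun r => e (γ r)) s := by
  rw [← contMDiffAt_iff_contDiffAt]
  exact ((contMDiffOn_chart he).contMDiffAt (e.open_source.mem_nhds hs)).comp s hγ

lemma velocity_eq (he : e ∈ atlas (Model n) M) (hI : I ∈ 𝓝 s)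
    (hγ : ContMDiffAt 𝓘(ℝ, ℝ) (𝓡 n) ∞ γ s) (hs : γ s ∈ e.source) :
    velocity n I γ s = ofCoord e (γ s) (deriv (fun r => e (γ r)) s) := by
  rw [velocity, mfderivWithin_of_mem_nhds hI, ← fderiv_apply_one_eq_deriv, ← mfderiv_eq_fderiv]
  have h1 : mfderiv 𝓘(ℝ, ℝ) 𝓘(ℝ, Model n) (e ∘ γ) s =
      (mfderiv (𝓡 n) 𝓘(ℝ, Model n) e (γ s)).comp (mfderiv 𝓘(ℝ, ℝ) (𝓡 n) γ s) :=
    mfderiv_comp s ((mdifferentiable_chart_of_mem_atlas he).mdifferentiableAt hs)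
      (hγ.mdifferentiableAt (by simp))
  have h2 := ofCoord_mfderiv he hs (mfderiv 𝓘(ℝ, ℝ) (𝓡 n) γ s (1 : ℝ))
  rw [← h2]
  congr 1
  exact (DFunLike.congr_fun h1 (1 : ℝ)).symm

variable [RiemannianBundle (fun x : M => TangentSpace (𝓡 n) x)]
  [IsContMDiffRiemannianBundle (𝓡 n) ∞ (Model n) (fun x : M => TangentSpace (𝓡 n) x)]

/-- The tension can be computed in any chart of the atlas. -/
lemma tension_eq (he : e ∈ atlas (Model n) M) (hI : I ∈ 𝓝 s)
    (hγ : ContMDiffAt 𝓘(ℝ, ℝ) (𝓡 n) ∞ γ s) (hs : γ s ∈ e.source) :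
    tension n I γ s = ofCoord e (γ s)
      (covD (metricInChart e) (fun r => e (γ r)) (deriv fun r => e (γ r)) s) := by
  have he' := chart_mem_atlas (Model n) (γ s)
  have hs' := mem_chart_source (Model n) (γ s)
  unfold tension
  generalize chartAt (Model n) (γ s) = e' at he' hs'
  simp only
  rw [covDerivAlong_eq_covD _ _ hI]
  set c : ℝ → Model n := fun r => e (γ r) with hcdef
  set φ : Model n → Model n := fun y => e' (e.symm y) with hφdef
  have hcs : c s ∈ e.target := e.map_source hs
  have hsymm : e.symm (c s) = γ s := e.left_inv hs
  have hφO := contDiffOn_coordChange he he'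
  have hO := (e.symm.trans e').open_source
  have hcO : c s ∈ (e.symm.trans e').source := by
    rw [OpenPartialHomeomorph.trans_source]
    exact ⟨hcs, by rw [mem_preimage, hsymm]; exact hs'⟩
  have hφ : ContDiffAt ℝ ∞ φ (c s) := hφO.contDiffAt (hO.mem_nhds hcO)
  have hc : ContDiffAt ℝ ∞ c s := contDiffAt_chart_comp he hγ hs
  have hev : (fun r => e' (γ r)) =ᶠ[𝓝 s] fun r => φ (c r) := by
    filter_upwards [hγ.continuousAt.preimage_mem_nhds (e.open_source.mem_nhds hs)] with r hr
    rw [hφdef, hcdef]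
    simp only
    rw [e.left_inv hr]
  have hcsmooth : ∀ᶠ r in 𝓝 s, ContDiffAt ℝ 1 c r :=
    (hc.of_le (by simp)).eventually (by simp)
  have hd : deriv (fun r => e' (γ r)) =ᶠ[𝓝 s] fun r => fderiv ℝ φ (c r) (deriv c r) := by
    filter_upwards [hev.eventuallyEq_nhds, hcsmooth,
      hc.continuousAt.preimage_mem_nhds (hO.mem_nhds hcO)] with r hr hcr hrO
    rw [hr.deriv_eq]
    exact (((hφO.contDiffAt (hO.mem_nhds hrO)).differentiableAt
      (by simp)).hasFDerivAt.comp_hasDerivAt r (hcr.differentiableAt (by simp)).hasDerivAt).deriv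
  have hc1 : HasDerivAt c (deriv c s) s := (hc.differentiableAt (by simp)).hasDerivAt
  have hc2 : HasDerivAt (deriv c) (deriv (deriv c) s) s :=
    ((hc.derivWithin (m := ∞) (by simp)).differentiableAt (by simp)).hasDerivAt
  have hDφ : HasFDerivAt (fderiv ℝ φ) (fderiv ℝ (fderiv ℝ φ) (c s)) (c s) :=
    ((hφ.fderiv_right (m := ∞) (by simp)).differentiableAt (by simp)).hasFDerivAt
  have hdd : deriv (deriv fun r => e' (γ r)) s =
      fderiv ℝ (fderiv ℝ φ) (c s) (deriv c s) (deriv c s)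
        + fderiv ℝ φ (c s) (deriv (deriv c) s) := by
    rw [hd.deriv_eq]
    exact ((hDφ.comp_hasDerivAt s hc1).clm_apply hc2).deriv
  have hpull := (isMetricOn_metricInChart he).christoffel_pullback (isMetricOn_metricInChart he')
    hcs (show φ (c s) ∈ e'.target by
      rw [hφdef]; simp only; rw [hsymm]; exact e'.map_source hs') hφ
    (fun v => ⟨mfderiv (𝓡 n) 𝓘(ℝ, Model n) e (γ s) (ofCoord e' (γ s) v), by
      have h1 := ofCoord_fderiv_coordChange he he' hs hs'
        (mfderiv (𝓡 n) 𝓘(ℝ, Model n) e (γ s) (ofCoord e' (γ s) v))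
      rw [ofCoord_mfderiv he hs] at h1
      have h2 := congrArg (mfderiv (𝓡 n) 𝓘(ℝ, Model n) e' (γ s)) h1
      rw [mfderiv_ofCoord he' hs', mfderiv_ofCoord he' hs'] at h2
      exact h2⟩)
    (by
      filter_upwards [hO.mem_nhds hcO] with y hy v w
      rw [OpenPartialHomeomorph.trans_source] at hy
      have h1 := ofCoord_fderiv_coordChange he he' (e.map_target hy.1) hy.2
      rw [e.right_inv hy.1] at h1
      rw [metricInChart_apply, ← h1, ← h1, inner_ofCoord hy.2])
  have hcov : covD (metricInChart e') (fun r => e' (γ r)) (deriv fun r => e' (γ r)) s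
      = fderiv ℝ φ (c s) (covD (metricInChart e) c (deriv c) s) := by
    have h1 : e' (γ s) = φ (c s) := hev.self_of_nhds
    have h2 : deriv (fun r => e' (γ r)) s = fderiv ℝ φ (c s) (deriv c s) := hd.self_of_nhds
    rw [covD, covD, hdd, h1, h2, map_add, hpull]
    abel
  rw [hcov]
  exact ofCoord_fderiv_coordChange he he' hs hs' _

end Curves

/-! ### Variations supported in a chart -/

section Variations

lemma IsCurveOn.mono {E : Type*} [NormedAddCommGroup E] [NormedSpace ℝ E] {U : Set E}
    {J J' : Set ℝ} {c : ℝ → E} (hc : IsCurveOn U J c) (hJ' : IsOpen J') (hsub : J' ⊆ J) :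
    IsCurveOn U J' c :=
  ⟨hJ', hc.smooth.mono hsub, hc.mapsTo.mono_left hsub⟩

lemma IsCurveOn.sqTension_eq {E : Type*} [NormedAddCommGroup E] [NormedSpace ℝ E] {U : Set E}
    {J : Set ℝ} {c c' V : ℝ → E} (G : E → E →L[ℝ] E →L[ℝ] ℝ) (hc : IsCurveOn U J c)
    (hV : ContDiffOn ℝ ∞ V J) {s t : ℝ} (hs : s ∈ J)
    (hc' : c' =ᶠ[𝓝 s] fun r => c r + t • V r) :
    sqTension G c V t s = G (c' s) (covD G c' (deriv c') s) (covD G c' (deriv c') s) := by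
  have hd : ∀ {a b : ℝ → E}, ContDiffOn ℝ ∞ a J → ContDiffOn ℝ ∞ b J → ∀ r ∈ J,
      deriv (fun r => a r + t • b r) r = deriv a r + t • deriv b r := fun ha hb r hr =>
    ((hasDerivAt_of_contDiffOn hc.isOpen ha hr).add
      ((hasDerivAt_of_contDiffOn hc.isOpen hb hr).const_smul t)).deriv
  have h1 : deriv c' =ᶠ[𝓝 s] fun r => deriv c r + t • deriv V r := by
    filter_upwards [hc'.eventuallyEq_nhds, hc.isOpen.mem_nhds hs] with r hr hrJ
    rw [hr.deriv_eq, hd hc.smooth hV r hrJ]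
  have h2 : deriv (deriv c') s = deriv (deriv c) s + t • deriv (deriv V) s := by
    rw [h1.deriv_eq, hd hc.smooth_deriv (contDiffOn_deriv hc.isOpen hV) s hs]
  have h3 : c' s = c s + t • V s := hc'.self_of_nhds
  have h4 : deriv c' s = deriv c s + t • deriv V s := h1.self_of_nhds
  rw [covD, h2, h3, h4]
  rfl

variable {n : ℕ} {M : Type*} [TopologicalSpace M] [ChartedSpace (Model n) M]
  [IsManifold (𝓡 n) ∞ M]
  {e : OpenPartialHomeomorph M (Model n)} {γ : ℝ → M} {I J : Set ℝ} {V : ℝ → Model n} {a b : ℝ}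

lemma isCurveOn_chart_comp (he : e ∈ atlas (Model n) M)
    (hγ : ContMDiffOn 𝓘(ℝ, ℝ) (𝓡 n) ∞ γ I) (hJ : IsOpen J) (hJI : J ⊆ I)
    (hJe : ∀ s ∈ J, γ s ∈ e.source) : IsCurveOn e.target J (fun s => e (γ s)) where
  isOpen := hJ
  smooth := fun s hs => (contDiffAt_chart_comp he
    (hγ.contMDiffAt (Filter.mem_of_superset (hJ.mem_nhds hs) hJI)) (hJe s hs)).contDiffWithinAt
  mapsTo := fun s hs => e.map_source (hJe s hs)

/-- The variation `c + t V` in a chart, extended by `γ` outside the support of `V`. -/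
lemma exists_isVariation (he : e ∈ atlas (Model n) M)
    (hγ : ContMDiffOn 𝓘(ℝ, ℝ) (𝓡 n) ∞ γ I) (hJ : IsOpen J) (hJI : J ⊆ I)
    (hJe : ∀ s ∈ J, γ s ∈ e.source) (hsub : Icc a b ⊆ J) (hV : ContDiffOn ℝ ∞ V J)
    (hV0 : ∀ s, s ∉ Ioo a b → V s = 0) :
    ∃ ε > 0, ∃ Γ : ℝ → ℝ → M, IsVariation n I γ a b ε Γ ∧
      ∀ t ∈ Ioo (-ε) ε, ∀ s ∈ Icc a b, e (γ s) + t • V s ∈ e.target ∧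
        Γ t =ᶠ[𝓝 s] fun r => e.symm (e (γ r) + t • V r) := by
  set c : ℝ → Model n := fun s => e (γ s) with hcdef
  have hc : IsCurveOn e.target J c := isCurveOn_chart_comp he hγ hJ hJI hJe
  set O : Set (ℝ × ℝ) := {q | q.2 ∈ J ∧ c q.2 + q.1 • V q.2 ∈ e.target} with hOdef
  have hO : IsOpen O := hc.isOpen_domain e.open_target hV
  have h0O : ({0} : Set ℝ) ×ˢ Icc a b ⊆ O := by
    rintro ⟨t, s⟩ ⟨rfl, hs⟩
    exact ⟨hsub hs, by simpa using hc.mapsTo (hsub hs)⟩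
  obtain ⟨u, v, hu, -, h0u, hbv, huv⟩ := generalized_tube_lemma (s := {(0 : ℝ)}) (t := Icc a b)
    isCompact_singleton isCompact_Icc hO h0O
  -- By compactness of `[a, b]` the variation stays in the chart for `|t| < ε`.
  obtain ⟨ε, hε, hball⟩ := Metric.isOpen_iff.1 hu 0 (h0u (mem_singleton (0 : ℝ)))
  rw [Real.ball_eq_Ioo, zero_sub, zero_add] at hball
  have hεO : ∀ t ∈ Ioo (-ε) ε, ∀ s ∈ Icc a b, (t, s) ∈ O := fun t ht s hs =>
    huv ⟨hball ht, hbv hs⟩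
  set Γ : ℝ → ℝ → M := fun t s => if s ∈ Ioo a b then e.symm (c s + t • V s) else γ s with hΓdef
  have hΓJ : ∀ t, ∀ s ∈ J, Γ t s = e.symm (c s + t • V s) := by
    intro t s hs
    by_cases hsab : s ∈ Ioo a b
    · exact if_pos hsab
    · rw [hV0 s hsab, smul_zero, add_zero, e.left_inv (hJe s hs)]
      exact if_neg hsab
  have hΓJe : ∀ t, ∀ s ∈ J, Γ t =ᶠ[𝓝 s] fun r => e.symm (c r + t • V r) := by
    intro t s hs
    filter_upwards [hJ.mem_nhds hs] with r hr using hΓJ t r hr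
  refine ⟨ε, hε, Γ, ⟨?_, ?_, ?_⟩, fun t ht s hs => ⟨(hεO t ht s hs).2, hΓJe t s (hsub hs)⟩⟩
  · rintro ⟨t, s⟩ ⟨ht, hs⟩
    by_cases hsab : s ∈ Icc a b
    · have hq := hεO t ht s hsab
      have hJ2 : Prod.snd ⁻¹' J ∈ 𝓝 (t, s) :=
        (hJ.preimage continuous_snd).mem_nhds (hsub hsab)
      have hsmooth : ContDiffAt ℝ ∞ (fun q : ℝ × ℝ => c q.2 + q.1 • V q.2) (t, s) :=
        ((hc.smooth.contDiffAt (hJ.mem_nhds (hsub hsab))).comp (t, s) contDiffAt_snd).add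
          (contDiffAt_fst.smul ((hV.contDiffAt (hJ.mem_nhds (hsub hsab))).comp (t, s)
            contDiffAt_snd))
      have h1 := ((contMDiffOn_chart_symm he).contMDiffAt (e.open_target.mem_nhds hq.2)).comp
        (t, s) hsmooth.contMDiffAt
      refine (h1.congr_of_eventuallyEq ?_).contMDiffWithinAt
      filter_upwards [hJ2] with q hq using hΓJ q.1 q.2 hq
    · have h1 : ContMDiffWithinAt 𝓘(ℝ, ℝ × ℝ) (𝓡 n) ∞ (fun q : ℝ × ℝ => γ q.2)
          (Ioo (-ε) ε ×ˢ I) (t, s) :=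
        (hγ s hs).comp (t, s) contDiff_snd.contMDiff.contMDiffAt.contMDiffWithinAt
          fun q hq => hq.2
      refine h1.congr_of_eventuallyEq ?_ (if_neg fun h => hsab (Ioo_subset_Icc_self h))
      refine Filter.Eventually.filter_mono nhdsWithin_le_nhds ?_
      filter_upwards [(isClosed_Icc.isOpen_compl.preimage continuous_snd).mem_nhds
        (show (t, s) ∈ Prod.snd ⁻¹' (Icc a b)ᶜ from hsab)] with q hq
      exact if_neg fun h => hq (Ioo_subset_Icc_self h)
  · intro s hs
    by_cases hsab : s ∈ Ioo a b
    · rw [hΓJ 0 s (hsub (Ioo_subset_Icc_self hsab)), zero_smul, add_zero,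
        e.left_inv (hJe s (hsub (Ioo_subset_Icc_self hsab)))]
    · exact if_neg hsab
  · intro t _ s _ hsab
    exact if_neg hsab

variable [RiemannianBundle (fun x : M => TangentSpace (𝓡 n) x)]
  [IsContMDiffRiemannianBundle (𝓡 n) ∞ (Model n) (fun x : M => TangentSpace (𝓡 n) x)]

lemma sq_norm_tension {s : ℝ} (he : e ∈ atlas (Model n) M) (hI : I ∈ 𝓝 s)
    (hγ : ContMDiffAt 𝓘(ℝ, ℝ) (𝓡 n) ∞ γ s) (hs : γ s ∈ e.source) :
    ‖tension n I γ s‖ ^ 2 = metricInChart e (e (γ s))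
      (covD (metricInChart e) (fun r => e (γ r)) (deriv fun r => e (γ r)) s)
      (covD (metricInChart e) (fun r => e (γ r)) (deriv fun r => e (γ r)) s) := by
  rw [tension_eq he hI hγ hs, sq_norm_ofCoord hs]

/-- A `p`-biharmonic curve is critical for the energy in coordinates. -/
lemma IsPBiharmonic.hasDerivAt_sqTension {p : ℝ} (hbi : IsPBiharmonic n p I γ)
    (he : e ∈ atlas (Model n) M)
    (hγ : ContMDiffOn 𝓘(ℝ, ℝ) (𝓡 n) ∞ γ I) (hJ : IsOpen J) (hJI : J ⊆ I)
    (hJe : ∀ s ∈ J, γ s ∈ e.source) (hτ : ∀ s ∈ J, tension n I γ s ≠ 0)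
    (hab : a < b) (hsub : Icc a b ⊆ J) (hV : ContDiffOn ℝ ∞ V J)
    (hV0 : ∀ s, s ∉ Ioo a b → V s = 0) :
    HasDerivAt (fun t => 1 / p * ∫ s in a..b,
      sqTension (metricInChart e) (fun s => e (γ s)) V t s ^ (p / 2)) 0 0 := by
  obtain ⟨ε, hε, Γ, hΓ, hΓe⟩ := exists_isVariation he hγ hJ hJI hJe hsub hV hV0
  have hJint : J ⊆ interior I := interior_maximal hJI hJ
  have hc := isCurveOn_chart_comp he hγ hJ hJI hJe
  have h0 := hbi a b hab (hsub.trans hJint) (Or.inr fun s hs => hτ s (hsub hs)) ε hε Γ hΓ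
  refine h0.congr_of_eventuallyEq ?_
  filter_upwards [Ioo_mem_nhds (neg_lt_zero.2 hε) hε] with t ht
  rw [energy]
  congr 1
  refine intervalIntegral.integral_congr fun s hs => ?_
  rw [uIcc_of_le hab.le] at hs
  obtain ⟨htar, hev⟩ := hΓe t ht s hs
  have hsJ := hsub hs
  have hsmooth : ContDiffAt ℝ ∞ (fun r => e (γ r) + t • V r) s :=
    (hc.smooth.contDiffAt (hJ.mem_nhds hsJ)).add
      ((hV.contDiffAt (hJ.mem_nhds hsJ)).const_smul t)
  have hΓs : ContMDiffAt 𝓘(ℝ, ℝ) (𝓡 n) ∞ (Γ t) s :=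
    (((contMDiffOn_chart_symm he).contMDiffAt (e.open_target.mem_nhds htar)).comp s
      hsmooth.contMDiffAt).congr_of_eventuallyEq hev
  have hΓsrc : Γ t s ∈ e.source := by
    rw [hev.self_of_nhds]
    exact e.map_target htar
  have heq : (fun r => e (Γ t r)) =ᶠ[𝓝 s] fun r => e (γ r) + t • V r := by
    filter_upwards [hev, hsmooth.continuousAt.preimage_mem_nhds (e.open_target.mem_nhds htar)]
      with r hr hrt
    rw [hr, e.right_inv hrt]
  rw [hc.sqTension_eq (metricInChart e) hV hsJ heq,
    ← sq_norm_tension he (mem_interior_iff_mem_nhds.1 (hJint hsJ)) hΓs hΓsrc,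
    ← Real.rpow_natCast_mul (norm_nonneg _)]
  congr 1
  push_cast
  ring

end Variations

/-! ### Biharmonic curves and geodesics -/

section Geodesics

variable {n : ℕ} {M : Type*} [TopologicalSpace M] [ChartedSpace (Model n) M]
  [IsManifold (𝓡 n) ∞ M] [RiemannianBundle (fun x : M => TangentSpace (𝓡 n) x)]
  [IsContMDiffRiemannianBundle (𝓡 n) ∞ (Model n) (fun x : M => TangentSpace (𝓡 n) x)]
  {γ : ℝ → M} {I : Set ℝ} {p : ℝ}

/-- If the tension were non-zero at `s₀`, then `γ`, restricted to the parameters near `s₀` that stay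
in a chart and have non-zero tension, would contradict `IsCurveOn.not_critical`. -/
lemma IsPBiharmonic.tension_eq_zero_of_mem_interior (hM : HasNonposCurvature n M) (hp : 0 < p)
    (hγ : ContMDiffOn 𝓘(ℝ, ℝ) (𝓡 n) ∞ γ I) (hunit : IsUnitSpeed n I γ)
    (hbi : IsPBiharmonic n p I γ)
    (hhalf : p = 1 / 2 → HasConstantGeodesicCurvature n I γ) {s₀ : ℝ} (hs₀ : s₀ ∈ interior I) :
    tension n I γ s₀ = 0 := by
  by_contra hne
  set e := chartAt (Model n) (γ s₀) with hedef
  have he : e ∈ atlas (Model n) M := chart_mem_atlas _ _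
  have hs₀e : γ s₀ ∈ e.source := mem_chart_source _ _
  set c : ℝ → Model n := fun s => e (γ s) with hcdef
  set G := metricInChart e with hGdef
  have hG : IsMetricOn G e.target := isMetricOn_metricInChart he
  set J₀ : Set ℝ := interior I ∩ γ ⁻¹' e.source with hJ₀def
  have hJ₀ : IsOpen J₀ :=
    (hγ.continuousOn.mono interior_subset).isOpen_inter_preimage isOpen_interior e.open_source
  have hc₀ : IsCurveOn e.target J₀ c :=
    isCurveOn_chart_comp he hγ hJ₀ (inter_subset_left.trans interior_subset) fun s hs => hs.2
  set κ : ℝ → ℝ := fun s => G (c s) (covD G c (deriv c) s) (covD G c (deriv c) s) with hκdef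
  have hκ : ContDiffOn ℝ ∞ κ J₀ :=
    hc₀.contDiffOn_metric hG (hc₀.contDiffOn_covD hG hc₀.smooth_deriv)
      (hc₀.contDiffOn_covD hG hc₀.smooth_deriv)
  have hmem : ∀ s ∈ J₀, I ∈ 𝓝 s := fun s hs => mem_interior_iff_mem_nhds.1 hs.1
  have hnorm : ∀ s ∈ J₀, ‖tension n I γ s‖ ^ 2 = κ s := fun s hs =>
    sq_norm_tension he (hmem s hs) (hγ.contMDiffAt (hmem s hs)) hs.2
  set J : Set ℝ := J₀ ∩ κ ⁻¹' Ioi 0 with hJdef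
  have hJ : IsOpen J := hκ.continuousOn.isOpen_inter_preimage hJ₀ isOpen_Ioi
  have hJJ₀ : J ⊆ J₀ := inter_subset_left
  have hJI : J ⊆ I := fun s hs => interior_subset (hJJ₀ hs).1
  have hc : IsCurveOn e.target J c := hc₀.mono hJ hJJ₀
  have hs₀J : s₀ ∈ J := by
    have h0 : s₀ ∈ J₀ := ⟨hs₀, hs₀e⟩
    refine ⟨h0, ?_⟩
    rw [mem_preimage, mem_Ioi, ← hnorm s₀ h0]
    exact pow_pos (norm_pos_iff.2 hne) 2
  refine hc.not_critical hG ⟨s₀, hs₀J⟩ hp (hM e he) ?_ (fun s hs => hs.2) ?_ ?_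
  · intro s hs
    have h1 := hunit s (hJI hs)
    rw [velocity_eq he (hmem s (hJJ₀ hs)) (hγ.contMDiffAt (hmem s (hJJ₀ hs))) (hJJ₀ hs).2] at h1
    rw [hGdef, hcdef]
    simp only
    rw [← sq_norm_ofCoord (hJJ₀ hs).2, h1, one_pow]
  · intro a b hab hsub V hV hV0
    refine hbi.hasDerivAt_sqTension he hγ hJ hJI (fun s hs => (hJJ₀ hs).2) ?_ hab hsub hV hV0
    intro s hs h0
    have h1 := hnorm s (hJJ₀ hs)
    have h2 : 0 < κ s := hs.2
    rw [h0, norm_zero] at h1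
    linarith [h1]
  · intro hp2
    obtain ⟨k, hk⟩ := hhalf hp2
    exact ⟨k ^ 2, fun s hs => by rw [← hk s (hJI hs)]; exact (hnorm s (hJJ₀ hs)).symm⟩

/-- By continuity, the tension vanishes at an endpoint if it vanishes in the interior. -/
lemma isGeodesic_of_tension_eq_zero_interior (hI : I.OrdConnected) (hI' : I.Nontrivial)
    (hγ : ContMDiffOn 𝓘(ℝ, ℝ) (𝓡 n) ∞ γ I)
    (h0 : ∀ s ∈ interior I, tension n I γ s = 0) : IsGeodesic n I γ := by
  intro s₀ hs₀
  set e := chartAt (Model n) (γ s₀) with hedef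
  have he : e ∈ atlas (Model n) M := chart_mem_atlas _ _
  have hs₀e : γ s₀ ∈ e.source := mem_chart_source _ _
  have hG : IsMetricOn (metricInChart e) e.target := isMetricOn_metricInChart he
  set c : ℝ → Model n := fun s => e (γ s) with hcdef
  have hconv : Convex ℝ I := hI.convex
  have hint : (interior I).Nonempty := by
    obtain ⟨x, hx, y, hy, hxy⟩ := hI'.exists_lt
    refine ⟨(x + y) / 2, mem_interior_iff_mem_nhds.2 ?_⟩
    exact Filter.mem_of_superset (Icc_mem_nhds (by linarith) (by linarith)) (hI.out hx hy)
  obtain ⟨W, hW, hs₀W, hWe⟩ : ∃ W : Set ℝ, IsOpen W ∧ s₀ ∈ W ∧ ∀ s ∈ I ∩ W, γ s ∈ e.source := by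
    have h1 := (hγ.continuousOn s₀ hs₀).preimage_mem_nhdsWithin (e.open_source.mem_nhds hs₀e)
    obtain ⟨W, hW, hs₀W, hsub⟩ := mem_nhdsWithin.1 h1
    exact ⟨W, hW, hs₀W, fun s hs => hsub ⟨hs.2, hs.1⟩⟩
  -- One-sided derivatives on `I` agree with those on the part `I ∩ W` of `I` in the chart, where
  -- the coordinate expression of the tension is continuous.
  have hud : UniqueDiffOn ℝ (I ∩ W) := (uniqueDiffOn_convex hconv hint).inter hW
  have hc : ContDiffOn ℝ ∞ c (I ∩ W) := by
    rw [← contMDiffOn_iff_contDiffOn]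
    exact (contMDiffOn_chart he).comp (hγ.mono inter_subset_left) hWe
  have hcU : MapsTo c (I ∩ W) e.target := fun s hs => e.map_source (hWe s hs)
  have hdW : ∀ {f : ℝ → Model n}, ∀ s ∈ I ∩ W, derivWithin f I s = derivWithin f (I ∩ W) s :=
    fun s hs => (derivWithin_inter (hW.mem_nhds hs.2)).symm
  have hc1 : ContDiffOn ℝ ∞ (derivWithin c I) (I ∩ W) :=
    (hc.derivWithin hud (m := ∞) (by simp)).congr hdW
  have hc2 : ContDiffOn ℝ ∞ (derivWithin (derivWithin c I) I) (I ∩ W) :=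
    (hc1.derivWithin hud (m := ∞) (by simp)).congr hdW
  have hcov : ContinuousOn (covDerivAlong (metricInChart e) I c (derivWithin c I)) (I ∩ W) := by
    have h1 := ((hG.contDiffOn_christoffelCLM.comp hc hcU).clm_apply hc1).clm_apply hc1
    simp only [Function.comp_apply, christoffelCLM_apply] at h1
    exact (hc2.add h1).continuousOn
  have hzero : ∀ s ∈ interior I ∩ W,
      covDerivAlong (metricInChart e) I c (derivWithin c I) s = 0 := by
    intro s hs
    have hsI : I ∈ 𝓝 s := mem_interior_iff_mem_nhds.1 hs.1
    have hse := hWe s ⟨interior_subset hs.1, hs.2⟩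
    rw [covDerivAlong_eq_covD _ _ hsI]
    have h1 := h0 s hs.1
    rw [tension_eq he hsI (hγ.contMDiffAt hsI) hse] at h1
    exact (ofCoord_eq_zero_iff he hse).1 h1
  have hcl : s₀ ∈ closure (interior I ∩ W) := by
    have h1 : s₀ ∈ closure (interior I) := by
      rw [hconv.closure_interior_eq_closure_of_nonempty_interior hint]
      exact subset_closure hs₀
    rw [inter_comm]
    exact hW.inter_closure ⟨hs₀W, h1⟩
  have hlim := (hcov s₀ ⟨hs₀, hs₀W⟩).mono (inter_subset_inter_left W interior_subset)
  have := mem_closure_iff_nhdsWithin_neBot.1 hcl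
  have hz : covDerivAlong (metricInChart e) I c (derivWithin c I) s₀ = 0 := by
    refine tendsto_nhds_unique hlim (tendsto_const_nhds.congr' ?_)
    filter_upwards [self_mem_nhdsWithin] with s hs using (hzero s hs).symm
  change ofCoord e (γ s₀) (covDerivAlong (metricInChart e) I c (derivWithin c I) s₀) = 0
  rw [hz, map_zero]

end Geodesics

end PBiharmonic

end

theorem mainTheorem5 {n : ℕ} {M : Type*} [TopologicalSpace M] [T2Space M]
    [ChartedSpace (PBiharmonic.Model n) M] [IsManifold (𝓡 n) ∞ M]
    [RiemannianBundle (fun x : M => TangentSpace (𝓡 n) x)]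
    [IsContMDiffRiemannianBundle (𝓡 n) ∞ (PBiharmonic.Model n)
      (fun x : M => TangentSpace (𝓡 n) x)]
    (hM : PBiharmonic.HasNonposCurvature n M)
    (p : ℝ) (hp : 0 < p)
    (I : Set ℝ) (hI : I.OrdConnected) (hI' : I.Nontrivial)
    (γ : ℝ → M) (hγ : ContMDiffOn 𝓘(ℝ, ℝ) (𝓡 n) ∞ γ I)
    (hunit : PBiharmonic.IsUnitSpeed n I γ)
    (hbi : PBiharmonic.IsPBiharmonic n p I γ)
    (hhalf : p = 1 / 2 → PBiharmonic.HasConstantGeodesicCurvature n I γ) :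
    PBiharmonic.IsGeodesic n I γ :=
  PBiharmonic.isGeodesic_of_tension_eq_zero_interior hI hI' hγ fun _ hs =>
    PBiharmonic.IsPBiharmonic.tension_eq_zero_of_mem_interior hM hp hγ hunit hbi hhalf hs
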